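/- **Theorem 5.1.** Let $(M,g_L)$ be an oriented smooth Lorentzian 4-manifold (signature $(-,+,+,+)$), let $T$ be a smooth vector field with $g_L(T,T)=-1$, and let $h := g_L + 2\,T^\flat\otimes T^\flat$, where $T^\flat = g_L(T,\cdot)$, which is a Riemannian metric. Let $\mathrm{Rm}_L(a,b,c,d)=g_L(\nabla_a\nabla_b c-\nabla_b\nabla_a c-\nabla_{[a,b]}c,\,d)$ be the Riemann curvature 4-tensor of $g_L$, where $\nabla$ is the Levi-Civita connection of $g_L$. Let $\langle\,,\rangle_h$ be the inner product on $\Lambda^2=\Lambda^2(T_pM)$ with $\langle v_1\wedge w_1,v_2\wedge w_2\rangle_h = h(v_1,v_2)h(w_1,w_2)-h(v_1,w_2)h(w_1,v_2)$, and let $\star_h$ be the Hodge star operator on $\Lambda^2$, $\xi\wedge\star_h\eta=\langle\xi,\eta\rangle_h\,dV$ with $dV=e_1\wedge e_2\wedge e_3\wedge e_4$ for any oriented $h$-orthonormal basis $(e_i)$. For a 4-tensor $R$ on $T_pM$ with the algebraic symmetries of a curvature tensor (antisymmetry in the first and in the last two arguments, pair symmetry, first Bianchi identity), let $\hat R\colon\Lambda^2\to\Lambda^2$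 be the endomorphism with $$R(v,w,x,y) = -\langle \hat R(v\wedge w),x\wedge y\rangle_h ;$$ it is $\langle\,,\rangle_h$-self-adjoint. Write $q_R(P)=\langle\hat R P,P\rangle_h$ for $P$ in the Grassmannian of oriented 2-planes, i.e. the manifold of decomposable $P\in\Lambda^2$ with $\langle P,P\rangle_h=1$. Call $g_L$ *$\star_h$-Einstein* if $\hat R\circ\star_h=\star_h\circ\hat R$ for $R=\mathrm{Rm}_L$ at every point of $M$. 1. $g_L$ is $\star_h$-Einstein if and only if $\mathrm{tr}_h(\mathrm{Rm}_L) = f\,h$ for some smooth function $f$ on $M$, where $\mathrm{tr}_h(\mathrm{Rm}_L)(v,w)=\sum_i \mathrm{Rm}_L(e_i,v,w,e_i)$ for any $h$-orthonormal basis $(e_i)$. 2. Suppose that $g_L$ is $\star_h$-Einstein. Then at every $p\in M$, with $R=\mathrm{Rm}_L|_p$: (a) (Unique normal form.) There are unique real numbers $\lambda_1,\lambda_2,\lambda_3,\mu_1,\mu_2,\mu_3$ with $$\lambda_1+\mu_1\ge\lambda_2+\mu_2\ge\lambda_3+\mu_3,\qquad \lambda_1-\mu_1\ge\lambda_2-\mu_2\ge\lambda_3-\mu_3$$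 for which there is an oriented $h$-orthonormal basis $e_1,e_2,e_3,e_4$ of $T_pM$ such that, with $P_1=e_1\wedge e_2$, $P_2=e_1\wedge e_3$, $P_3=e_1\wedge e_4$ and $\star_hP_1=e_3\wedge e_4$, $\star_hP_2=e_4\wedge e_2$, $\star_hP_3=e_2\wedge e_3$, all of the $P_i$ and $\star_hP_i$ are critical points of $q_R$ and $$\hat R P_i=\lambda_iP_i+\mu_i\star_hP_i,\qquad \hat R(\star_hP_i)=\mu_iP_i+\lambda_i\star_hP_i\qquad(i=1,2,3).$$ (b) (Determined by critical points and values.) If $R'$ is a 4-tensor on $T_pM$ with the algebraic symmetries of a curvature tensor whose operator $\hat R'$ commutes with $\star_h$, and if $q_{R'}$ and $q_R$ have the same critical points and take equal values at each of them, then $R'=R$ and $\hat R'=\hat R$. -/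

import Mathlib

open Module
open scoped Manifold ContDiff Topology Bundle

noncomputable section

namespace LorentzNormalForm

/-! ### Algebra of a four-dimensional oriented vector space with an inner product -/

section Algebra

variable {V : Type*} [AddCommGroup V] [Module ℝ V]

/-- The 2-vector `v ∧ w`. -/
def wedge (v w : V) : ⋀[ℝ]^2 V := exteriorPower.ιMulti ℝ 2 ![v, w]

/-- The inner product induced by `h` on 2-vectors, i.e. the bilinear form with
`⟨v₁ ∧ w₁, v₂ ∧ w₂⟩ = h(v₁, v₂) h(w₁, w₂) - h(v₁, w₂) h(w₁, v₂)`
(see `ip2_wedge`). -/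
def ip2 (h : LinearMap.BilinForm ℝ V) : LinearMap.BilinForm ℝ (⋀[ℝ]^2 V) :=
  (exteriorPower.pairingDual ℝ V 2).comp (exteriorPower.map 2 h)

theorem ip2_wedge (h : LinearMap.BilinForm ℝ V) (v₁ w₁ v₂ w₂ : V) :
    ip2 h (wedge v₁ w₁) (wedge v₂ w₂) = h v₁ v₂ * h w₁ w₂ - h v₁ w₂ * h w₁ v₂ := by
  simp only [ip2, wedge, LinearMap.comp_apply, exteriorPower.map_apply_ιMulti,
    exteriorPower.pairingDual_ιMulti_ιMulti, Matrix.det_fin_two]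
  simp [mul_comm]

/-- `e` is an `h`-orthonormal frame (for positive definite `h`). -/
def IsOrthonormalFrame (h : LinearMap.BilinForm ℝ V) (e : Fin 4 → V) : Prop :=
  ∀ i j, h (e i) (e j) = if i = j then 1 else 0

/-- `e` is a basis inducing the orientation `o`. -/
def IsPositiveFrame (o : Orientation ℝ V (Fin 4)) (e : Fin 4 → V) : Prop :=
  ∃ b : Basis (Fin 4) ℝ V, ⇑b = e ∧ b.orientation = o

/-- `S` satisfies `ξ ∧ S η = ⟨ξ, η⟩ dV` for all 2-vectors `ξ`, `η`, where
`dV = e₀ ∧ e₁ ∧ e₂ ∧ e₃` for every positively oriented orthonormal frame `e`.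
The wedge products are taken in the exterior algebra. -/
def IsHodgeStar (h : LinearMap.BilinForm ℝ V) (o : Orientation ℝ V (Fin 4))
    (S : ⋀[ℝ]^2 V →ₗ[ℝ] ⋀[ℝ]^2 V) : Prop :=
  ∀ e : Fin 4 → V, IsOrthonormalFrame h e → IsPositiveFrame o e → ∀ ξ η : ⋀[ℝ]^2 V,
    (ξ : ExteriorAlgebra ℝ V) * (S η : ExteriorAlgebra ℝ V) =
      ip2 h ξ η • ExteriorAlgebra.ιMulti ℝ 4 e

/-- The Hodge star operator on 2-vectors of the inner product `h` and the orientation `o`. -/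
def hodgeStar (h : LinearMap.BilinForm ℝ V) (o : Orientation ℝ V (Fin 4)) :
    ⋀[ℝ]^2 V →ₗ[ℝ] ⋀[ℝ]^2 V :=
  Classical.epsilon (IsHodgeStar h o)

/-- Algebraic curvature tensors: 4-linear forms with all the symmetries of a Riemann tensor
(linearity in the other arguments follows from the symmetries). -/
structure IsAlgCurvatureTensor (R : V → V → V → V → ℝ) : Prop where
  add : ∀ u v w x y, R (u + v) w x y = R u w x y + R v w x y
  smul : ∀ (c : ℝ) v w x y, R (c • v) w x y = c * R v w x y
  antisymm : ∀ v w x y, R v w x y = -R w v x y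
  pairSymm : ∀ v w x y, R v w x y = R x y v w
  bianchi : ∀ v w x y, R v w x y + R w x v y + R x v w y = 0

/-- `A` satisfies `R(v, w, x, y) = -⟨A(v ∧ w), x ∧ y⟩_h`. -/
def IsCurvatureOperator (h : LinearMap.BilinForm ℝ V) (R : V → V → V → V → ℝ)
    (A : ⋀[ℝ]^2 V →ₗ[ℝ] ⋀[ℝ]^2 V) : Prop :=
  ∀ v w x y, R v w x y = -ip2 h (A (wedge v w)) (wedge x y)

/-- The endomorphism `R̂` of the space of 2-vectors built from a curvature tensor `R`
(possibly the one of another metric) with the help of `h`: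
`R(v, w, x, y) = -⟨R̂(v ∧ w), x ∧ y⟩_h`. -/
def curvatureOperator (h : LinearMap.BilinForm ℝ V) (R : V → V → V → V → ℝ) :
    ⋀[ℝ]^2 V →ₗ[ℝ] ⋀[ℝ]^2 V :=
  Classical.epsilon (IsCurvatureOperator h R)

/-- `R̂ ∘ ⋆ = ⋆ ∘ R̂`. -/
def CommutesWithStar (h : LinearMap.BilinForm ℝ V) (o : Orientation ℝ V (Fin 4))
    (R : V → V → V → V → ℝ) : Prop :=
  curvatureOperator h R ∘ₗ hodgeStar h o = hodgeStar h o ∘ₗ curvatureOperator h R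

/-- The trace `tr_h(R)(v, w) = h^{ij} R(bᵢ, v, w, bⱼ)` over the first and last arguments, where
`b` is a basis and `h^{ij}` is the inverse of the matrix of `h` in it. -/
def metricTrace [FiniteDimensional ℝ V] (h : LinearMap.BilinForm ℝ V)
    (R : V → V → V → V → ℝ) (v w : V) : ℝ :=
  ∑ i, ∑ j, (Matrix.of fun k l => h (finBasis ℝ V k) (finBasis ℝ V l))⁻¹ i j *
    R (finBasis ℝ V i) v w (finBasis ℝ V j)

/-- The Grassmannian of oriented 2-planes: the decomposable 2-vectors of `h`-length one. -/
def unitPlanes (h : LinearMap.BilinForm ℝ V) : Set (⋀[ℝ]^2 V) :=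
  {P | ip2 h P P = 1 ∧ ∃ v w, P = wedge v w}

/-- The quadratic form `P ↦ ⟨R̂ P, P⟩_h`. -/
def curvatureForm (h : LinearMap.BilinForm ℝ V) (R : V → V → V → V → ℝ) (P : ⋀[ℝ]^2 V) : ℝ :=
  ip2 h (curvatureOperator h R P) P

/-- A curve in the (finite-dimensional) space of 2-vectors is smooth if all its
coordinates are. -/
def IsSmoothCurve (c : ℝ → ⋀[ℝ]^2 V) : Prop :=
  ∀ φ : Dual ℝ (⋀[ℝ]^2 V), ContDiff ℝ ∞ (fun t => φ (c t))

/-- `P` is a critical point of the restriction of `P ↦ ⟨R̂ P, P⟩_h` to the Grassmannian of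
oriented 2-planes: its derivative vanishes along each smooth curve of the Grassmannian
through `P`. -/
def IsCriticalPlane (h : LinearMap.BilinForm ℝ V) (R : V → V → V → V → ℝ)
    (P : ⋀[ℝ]^2 V) : Prop :=
  P ∈ unitPlanes h ∧ ∀ c : ℝ → ⋀[ℝ]^2 V, IsSmoothCurve c → (∀ t, c t ∈ unitPlanes h) → c 0 = P →
    HasDerivAt (fun t => curvatureForm h R (c t)) 0 0

/-- The planes `e₀ ∧ e₁`, `e₀ ∧ e₂`, `e₀ ∧ e₃` of a frame. -/
def framePlane (e : Fin 4 → V) : Fin 3 → ⋀[ℝ]^2 V :=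
  ![wedge (e 0) (e 1), wedge (e 0) (e 2), wedge (e 0) (e 3)]

/-- The complementary planes `e₂ ∧ e₃`, `e₃ ∧ e₁`, `e₁ ∧ e₂` of a frame. -/
def framePlanePerp (e : Fin 4 → V) : Fin 3 → ⋀[ℝ]^2 V :=
  ![wedge (e 2) (e 3), wedge (e 3) (e 1), wedge (e 1) (e 2)]

/-- The positively oriented orthonormal frame `e` puts `R̂` in normal form with constants
`lam`, `mu`: the six coordinate planes are critical points of `P ↦ ⟨R̂ P, P⟩_h`, the last three
of them are the Hodge duals `⋆ Pᵢ` of the first three `Pᵢ`, and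
`R̂ Pᵢ = lam i • Pᵢ + mu i • ⋆ Pᵢ`, `R̂ (⋆ Pᵢ) = mu i • Pᵢ + lam i • ⋆ Pᵢ`. -/
structure IsNormalFrame (h : LinearMap.BilinForm ℝ V) (o : Orientation ℝ V (Fin 4))
    (R : V → V → V → V → ℝ) (lam mu : Fin 3 → ℝ) (e : Fin 4 → V) : Prop where
  orthonormal : IsOrthonormalFrame h e
  positive : IsPositiveFrame o e
  star : ∀ i, hodgeStar h o (framePlane e i) = framePlanePerp e i
  critical : ∀ i, IsCriticalPlane h R (framePlane e i)
  critical_perp : ∀ i, IsCriticalPlane h R (framePlanePerp e i)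
  apply : ∀ i, curvatureOperator h R (framePlane e i) =
    lam i • framePlane e i + mu i • framePlanePerp e i
  apply_perp : ∀ i, curvatureOperator h R (framePlanePerp e i) =
    mu i • framePlane e i + lam i • framePlanePerp e i

end Algebra

/-! ### Curvature of a semi-Riemannian metric on a vector space, in coordinates -/

section Coordinates

variable {E : Type*} [NormedAddCommGroup E] [NormedSpace ℝ E]

/-- Christoffel symbols of the first kind of the metric `G`: `christoffelLower G y u v` is the
linear form `w ↦ ½ (∂_u G(v, w) + ∂_v G(u, w) - ∂_w G(u, v))` at the point `y`
(see `christoffelLower_apply`). -/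
def christoffelLower (G : E → E →L[ℝ] E →L[ℝ] ℝ) (y u v : E) : E →L[ℝ] ℝ :=
  (2⁻¹ : ℝ) • (fderiv ℝ G y u v + fderiv ℝ G y v u - ((fderiv ℝ G y).flip u).flip v)

theorem christoffelLower_apply (G : E → E →L[ℝ] E →L[ℝ] ℝ) (y u v w : E) :
    christoffelLower G y u v w =
      2⁻¹ * (fderiv ℝ G y u v w + fderiv ℝ G y v u w - fderiv ℝ G y w u v) := by
  simp [christoffelLower]

/-- The Christoffel symbol `Γ_y(u, v)`, i.e. the covariant derivative at `y` of the constant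
vector field `v` in the direction `u`, for the Levi-Civita connection of `G`. It is obtained
from `christoffelLower` by raising the index with the inverse of `G y : E → E*`. -/
def christoffel (G : E → E →L[ℝ] E →L[ℝ] ℝ) (y u v : E) : E :=
  ContinuousLinearMap.inverse (G y) (christoffelLower G y u v)

/-- `R(u, v)w = ∇_u ∇_v w - ∇_v ∇_u w` for constant vector fields `u`, `v`, `w`. -/
def riemannEndo (G : E → E →L[ℝ] E →L[ℝ] ℝ) (y u v w : E) : E :=
  fderiv ℝ (fun x => christoffel G x v w) y u - fderiv ℝ (fun x => christoffel G x u w) y v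
    + christoffel G y u (christoffel G y v w) - christoffel G y v (christoffel G y u w)

/-- The Riemann 4-tensor `R(u, v, w, z) = G(R(u, v)w, z)` at `y`. -/
def riemannForm (G : E → E →L[ℝ] E →L[ℝ] ℝ) (y u v w z : E) : ℝ :=
  G y (riemannEndo G y u v w) z

end Coordinates

/-! ### Oriented Lorentzian 4-manifolds -/

section Manifold

/-- The model space of 4-manifolds. -/
abbrev E4 : Type := EuclideanSpace ℝ (Fin 4)

variable (M : Type*) [TopologicalSpace M] [ChartedSpace E4 M]

/-- An orientation of the manifold `M`: a choice of orientation of each tangent space for which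
there is a positively oriented smooth local frame near each point. -/
structure ManifoldOrientation [IsManifold (𝓡 4) ∞ M] where
  orient : ∀ p : M, Orientation ℝ (TangentSpace (𝓡 4) p) (Fin 4)
  exists_frame : ∀ p : M, ∃ U : Set M, IsOpen U ∧ p ∈ U ∧
    ∃ X : Fin 4 → (q : M) → TangentSpace (𝓡 4) q,
      (∀ i, ContMDiffOn (𝓡 4) (𝓡 4).tangent ∞
        (fun q => (⟨q, X i q⟩ : TangentBundle (𝓡 4) M)) U) ∧
      ∀ q ∈ U, IsPositiveFrame (orient q) (fun i => X i q)

/-- A smooth Lorentzian metric, of signature `(-, +, +, +)`. -/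
structure LorentzianMetric [IsManifold (𝓡 4) ∞ M] where
  inner : ∀ p : M, TangentSpace (𝓡 4) p →L[ℝ] TangentSpace (𝓡 4) p →L[ℝ] ℝ
  symm : ∀ p v w, inner p v w = inner p w v
  signature : ∀ p, ∃ e : Fin 4 → TangentSpace (𝓡 4) p,
    ∀ i j, inner p (e i) (e j) = if i = j then (if i = 0 then -1 else 1) else 0
  contMDiff : ContMDiff (𝓡 4) ((𝓡 4).prod 𝓘(ℝ, E4 →L[ℝ] E4 →L[ℝ] ℝ)) ∞
    (fun p => Bundle.TotalSpace.mk' (E4 →L[ℝ] E4 →L[ℝ] ℝ)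
      (E := fun p => TangentSpace (𝓡 4) p →L[ℝ] TangentSpace (𝓡 4) p →L[ℝ] ℝ) p (inner p))

/-- A smooth vector field `T` with `g(T, T) = -1`. -/
structure UnitTimelikeField [IsManifold (𝓡 4) ∞ M] (g : LorentzianMetric M) where
  vec : ∀ p : M, TangentSpace (𝓡 4) p
  contMDiff : ContMDiff (𝓡 4) (𝓡 4).tangent ∞
    (fun p => (⟨p, vec p⟩ : TangentBundle (𝓡 4) M))
  unit : ∀ p, g.inner p (vec p) (vec p) = -1

instance (p : M) : FiniteDimensional ℝ (TangentSpace (𝓡 4) p) :=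
  inferInstanceAs (FiniteDimensional ℝ E4)

variable {M} [IsManifold (𝓡 4) ∞ M]

namespace LorentzianMetric

/-- The metric in the chart centred at `c`, i.e. its pullback under the inverse of the chart. -/
def inChart (g : LorentzianMetric M) (c : M) (y : E4) : E4 →L[ℝ] E4 →L[ℝ] ℝ :=
  let D : E4 →L[ℝ] TangentSpace (𝓡 4) ((extChartAt (𝓡 4) c).symm y) :=
    mfderiv 𝓘(ℝ, E4) (𝓡 4) (extChartAt (𝓡 4) c).symm y
  (ContinuousLinearMap.precomp ℝ D).comp ((g.inner ((extChartAt (𝓡 4) c).symm y)).comp D)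

theorem inChart_apply (g : LorentzianMetric M) (c : M) (y u v : E4) :
    g.inChart c y u v = g.inner ((extChartAt (𝓡 4) c).symm y)
      (mfderiv 𝓘(ℝ, E4) (𝓡 4) (extChartAt (𝓡 4) c).symm y u)
      (mfderiv 𝓘(ℝ, E4) (𝓡 4) (extChartAt (𝓡 4) c).symm y v) := rfl

/-- The value at `p` of the Riemann 4-tensor, computed in the chart centred at `c` (where `p` has
to be in the domain of that chart). -/
def riemannInChart (g : LorentzianMetric M) (c p : M) (u v w z : TangentSpace (𝓡 4) p) : ℝ :=
  let D : TangentSpace (𝓡 4) p →L[ℝ] E4 := mfderiv (𝓡 4) 𝓘(ℝ, E4) (extChartAt (𝓡 4) c) p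
  riemannForm (g.inChart c) (extChartAt (𝓡 4) c p) (D u) (D v) (D w) (D z)

/-- The Riemann curvature 4-tensor `R(u, v, w, z) = g(∇_u ∇_v w - ∇_v ∇_u w - ∇_[u, v] w, z)`
of `g`. -/
def riemann (g : LorentzianMetric M) (p : M) (u v w z : TangentSpace (𝓡 4) p) : ℝ :=
  g.riemannInChart p p u v w z

/-- The Riemannian metric `h = g + 2 T♭ ⊗ T♭`, where `T♭ = g(T, ·)`. -/
def deformation (g : LorentzianMetric M) (T : UnitTimelikeField M g) (p : M) :
    LinearMap.BilinForm ℝ (TangentSpace (𝓡 4) p) :=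
  LinearMap.mk₂ ℝ
    (fun v w => g.inner p v w + 2 * (g.inner p (T.vec p) v * g.inner p (T.vec p) w))
    (by intros; simp only [map_add, add_apply]; ring)
    (by intros; simp only [map_smul, smul_apply, smul_eq_mul]; ring)
    (by intros; simp only [map_add]; ring)
    (by intros; simp only [map_smul, smul_eq_mul]; ring)

/-- `g` is `⋆_h`-Einstein: at every point, the operator `R̂` with
`Rm_g(v, w, x, y) = -⟨R̂(v ∧ w), x ∧ y⟩_h` commutes with the Hodge star operator of
`h = g + 2 T♭ ⊗ T♭`. -/
def IsStarEinstein (g : LorentzianMetric M) (T : UnitTimelikeField M g)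
    (o : ManifoldOrientation M) : Prop :=
  ∀ p, CommutesWithStar (g.deformation T p) (o.orient p) (g.riemann p)

end LorentzianMetric

end Manifold

end LorentzNormalForm

end

/-! The tensor Rm_L has the algebraic symmetries of a curvature tensor; apart from this and the
smoothness of f, the theorem is linear algebra on Λ² with the positive definite form h. Since ⋆ is a
self-adjoint involution, Λ² splits into its eigenspaces Λ⁺ and Λ⁻, both of dimension three, and a
self-adjoint operator commuting with ⋆ is a pair of symmetric 3 × 3 blocks.

Two facts tie this splitting to the geometry of V. Suitably scaled unit vectors of Λ⁺ and Λ⁻ add up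
to a unit decomposable 2-vector, so S² × S² parametrizes planes (`dualMap_add_mem_unitPlanes`).
Moreover any two positively oriented orthonormal bases of Λ⁺ and Λ⁻ come from one positively
oriented orthonormal frame of V (`exists_frame`), which is the surjectivity of SO(4) → SO(3) ×
SO(3). Both follow from identifying V with the quaternions, where the two halves of x ∧ y are y x̄
and x̄ y (`wedge_quatVec`).

Diagonalizing the blocks gives the normal form, with eigenvalues λ + μ on Λ⁺ and λ - μ on Λ⁻. Once
sorted, they are read off from the characteristic polynomials of the blocks, hence unique.

For R̂ commuting with ⋆, a plane a + a' is critical exactly when a and a' are eigenvectors, and its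
value is the mean of the two eigenvalues. The values at the nine sums of eigenvectors determine the
spectrum up to adding a constant on Λ⁺ and subtracting it on Λ⁻. The first Bianchi identity says
that both blocks have the same trace and fixes that constant (`curvatureOperator_eq`).

The trace criterion compares components in an orthonormal frame (`commutesWithStar_iff`). The factor
f is the trace evaluated on (T, T), because h(T, T) = 1. It is smooth because it is the trace of u ↦
R(u, T)T, in which h no longer occurs (`metricTrace_vec_eq`). -/

set_option maxSynthPendingDepth 3

noncomputable section

namespace LorentzNormalForm

/-! ### Symmetries and coordinate invariance of the curvature of a metric on a vector space -/

section CoordinateCurvature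

theorem minSmoothness_two_le_infty : minSmoothness ℝ 2 ≤ (∞ : ℕ∞ω) := by
  rw [minSmoothness_of_isRCLikeNormedField]
  exact WithTop.coe_le_coe.2 (le_top : (2 : ℕ∞) ≤ ⊤)

variable {E : Type*} [NormedAddCommGroup E] [NormedSpace ℝ E]

/-- `G` is a smooth semi-Riemannian metric in a neighbourhood of `y`. -/
structure IsMetricNear (G : E → E →L[ℝ] E →L[ℝ] ℝ) (y : E) : Prop where
  smooth : ∀ᶠ x in 𝓝 y, ContDiffAt ℝ ∞ G x
  symm : ∀ᶠ x in 𝓝 y, ∀ u v, G x u v = G x v u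
  nondeg : ∀ᶠ x in 𝓝 y, (G x).IsInvertible

theorem IsMetricNear.eventually {G : E → E →L[ℝ] E →L[ℝ] ℝ} {y : E} (hG : IsMetricNear G y) :
    ∀ᶠ x in 𝓝 y, IsMetricNear G x := by
  filter_upwards [hG.smooth.eventually_nhds, hG.symm.eventually_nhds, hG.nondeg.eventually_nhds]
    with x h1 h2 h3 using ⟨h1, h2, h3⟩

/-- The Christoffel symbols as a bundled bilinear map. -/
def christoffelCLM (G : E → E →L[ℝ] E →L[ℝ] ℝ) (y : E) : E →L[ℝ] E →L[ℝ] E :=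
  (ContinuousLinearMap.compL ℝ E (E →L[ℝ] ℝ) E (ContinuousLinearMap.inverse (G y))).comp
    ((2⁻¹ : ℝ) • (fderiv ℝ G y + (fderiv ℝ G y).flip -
      (ContinuousLinearMap.flipₗᵢ ℝ E E ℝ : _ →L[ℝ] (E →L[ℝ] E →L[ℝ] ℝ)).comp (fderiv ℝ G y).flip))

theorem christoffelCLM_apply (G : E → E →L[ℝ] E →L[ℝ] ℝ) (y u v : E) :
    christoffelCLM G y u v = christoffel G y u v := by
  simp [christoffelCLM, christoffel, christoffelLower]

variable {G : E → E →L[ℝ] E →L[ℝ] ℝ} {y : E}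

theorem IsMetricNear.apply_christoffel (hG : IsMetricNear G y) (u v w : E) :
    G y (christoffel G y u v) w = christoffelLower G y u v w := by
  rw [christoffel]
  have := hG.nondeg.self_of_nhds
  rw [ContinuousLinearMap.IsInvertible.self_apply_inverse this]

theorem IsMetricNear.eq_of_apply_eq (hG : IsMetricNear G y) {u v : E}
    (h : ∀ w, G y u w = G y v w) : u = v := by
  obtain ⟨e, he⟩ := hG.nondeg.self_of_nhds
  apply e.injective
  ext w
  have := h w
  rw [← he] at this
  exact this

theorem hasFDerivAt_apply₂ {F : Type*} [NormedAddCommGroup F] [NormedSpace ℝ F]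
    {B : E → E →L[ℝ] E →L[ℝ] F} {B' : E →L[ℝ] E →L[ℝ] E →L[ℝ] F} {v w : E → E} {v' w' : E →L[ℝ] E}
    (hB : HasFDerivAt B B' y) (hv : HasFDerivAt v v' y) (hw : HasFDerivAt w w' y) (u : E) :
    DifferentiableAt ℝ (fun x => B x (v x) (w x)) y ∧
    fderiv ℝ (fun x => B x (v x) (w x)) y u =
      B' u (v y) (w y) + B y (v' u) (w y) + B y (v y) (w' u) := by
  have h := (hB.clm_apply hv).clm_apply hw
  refine ⟨h.differentiableAt, ?_⟩
  rw [h.fderiv]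
  simp
  abel

theorem fderiv_clm_apply_apply {F : Type*} [NormedAddCommGroup F] [NormedSpace ℝ F]
    {B : E → E →L[ℝ] F} {B' : E →L[ℝ] E →L[ℝ] F} {v : E → E} {v' : E →L[ℝ] E}
    (hB : HasFDerivAt B B' y) (hv : HasFDerivAt v v' y) (u : E) :
    fderiv ℝ (fun x => B x (v x)) y u = B' u (v y) + B y (v' u) := by
  rw [(hB.clm_apply hv).fderiv]
  simp [add_comm]

theorem IsMetricNear.differentiableAt (hG : IsMetricNear G y) : DifferentiableAt ℝ G y :=
  hG.smooth.self_of_nhds.differentiableAt (by simp)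

theorem IsMetricNear.fderiv_symm (hG : IsMetricNear G y) (u v w : E) :
    fderiv ℝ G y u v w = fderiv ℝ G y u w v := by
  have h1 := (hasFDerivAt_apply₂ hG.differentiableAt.hasFDerivAt (hasFDerivAt_const v y)
    (hasFDerivAt_const w y) u).2
  have h2 := (hasFDerivAt_apply₂ hG.differentiableAt.hasFDerivAt (hasFDerivAt_const w y)
    (hasFDerivAt_const v y) u).2
  have h3 : (fun x => G x v w) =ᶠ[𝓝 y] (fun x => G x w v) := hG.symm.mono fun x hx => hx v w
  rw [h3.fderiv_eq, h2] at h1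
  simpa using h1.symm

theorem IsMetricNear.christoffel_symm (hG : IsMetricNear G y) (u v : E) :
    christoffel G y u v = christoffel G y v u := by
  refine hG.eq_of_apply_eq fun w => ?_
  rw [hG.apply_christoffel, hG.apply_christoffel, christoffelLower_apply, christoffelLower_apply,
    hG.fderiv_symm w u v]
  ring

/-- Metric compatibility ∇G = 0: in the sum of the two Koszul expressions all derivatives but one
cancel by the symmetry of `G`. -/
theorem IsMetricNear.fderiv_eq_christoffel (hG : IsMetricNear G y) (u v w : E) :
    fderiv ℝ G y u v w = G y (christoffel G y u v) w + G y v (christoffel G y u w) := by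
  rw [hG.symm.self_of_nhds v, hG.apply_christoffel, hG.apply_christoffel, christoffelLower_apply,
    christoffelLower_apply, hG.fderiv_symm u w v, hG.fderiv_symm v u w, hG.fderiv_symm w u v]
  ring

theorem IsMetricNear.contDiffAt_fderiv (hG : IsMetricNear G y) : ContDiffAt ℝ ∞ (fderiv ℝ G) y :=
  hG.smooth.self_of_nhds.fderiv_right (by simp)

variable [FiniteDimensional ℝ E]

/-- In finite dimension an operator is a fixed linear combination of its values on a basis, so
smoothness may be tested vector by vector. -/
theorem contDiffAt_of_clm_apply {F : Type*} [NormedAddCommGroup F] [NormedSpace ℝ F] {n : ℕ∞ω}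
    {f : E → E →L[ℝ] F} (h : ∀ v, ContDiffAt ℝ n (fun x => f x v) y) : ContDiffAt ℝ n f y := by
  let b := finBasis ℝ E
  have hf : f = fun x => ∑ i, (ContinuousLinearMap.smulRightL ℝ E F
      (LinearMap.toContinuousLinearMap (b.coord i))) (f x (b i)) := by
    ext x v
    conv_lhs => rw [← b.sum_repr v, map_sum]
    simp
  rw [hf]
  exact ContDiffAt.sum fun i _ => (ContinuousLinearMap.contDiff _).contDiffAt.comp y (h _)

theorem IsMetricNear.contDiffAt_christoffel (hG : IsMetricNear G y) :
    ContDiffAt ℝ ∞ (christoffelCLM G) y := by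
  have : CompleteSpace E := FiniteDimensional.complete ℝ E
  refine contDiffAt_of_clm_apply fun u => ?_
  refine contDiffAt_of_clm_apply fun v => ?_
  simp only [christoffelCLM_apply, christoffel]
  have h1 : ContDiffAt ℝ ∞ (fun x => ContinuousLinearMap.inverse (G x)) y :=
    (hG.nondeg.self_of_nhds.contDiffAt_map_inverse).comp y hG.smooth.self_of_nhds
  refine h1.clm_apply ?_
  refine contDiffAt_of_clm_apply fun w => ?_
  simp only [christoffelLower_apply]
  have h2 : ∀ a b c : E, ContDiffAt ℝ ∞ (fun x => fderiv ℝ G x a b c) y := fun a b c =>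
    ((hG.contDiffAt_fderiv.clm_apply contDiffAt_const).clm_apply contDiffAt_const).clm_apply
      contDiffAt_const
  exact contDiffAt_const.mul (((h2 _ _ _).add (h2 _ _ _)).sub (h2 _ _ _))

theorem IsMetricNear.hasFDerivAt_christoffel (hG : IsMetricNear G y) :
    HasFDerivAt (christoffelCLM G) (fderiv ℝ (christoffelCLM G) y) y :=
  (hG.contDiffAt_christoffel.differentiableAt (by simp)).hasFDerivAt

theorem IsMetricNear.fderiv_christoffel (hG : IsMetricNear G y) (u v w : E) :
    fderiv ℝ (fun x => christoffel G x v w) y u = fderiv ℝ (christoffelCLM G) y u v w := by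
  have := (hasFDerivAt_apply₂ hG.hasFDerivAt_christoffel (hasFDerivAt_const v y)
    (hasFDerivAt_const w y) u).2
  simpa [← christoffelCLM_apply] using this

theorem IsMetricNear.riemannEndo_eq (hG : IsMetricNear G y) (u v w : E) :
    riemannEndo G y u v w = fderiv ℝ (christoffelCLM G) y u v w
      - fderiv ℝ (christoffelCLM G) y v u w + christoffelCLM G y u (christoffelCLM G y v w)
      - christoffelCLM G y v (christoffelCLM G y u w) := by
  simp only [riemannEndo, hG.fderiv_christoffel, christoffelCLM_apply]

theorem IsMetricNear.fderiv_christoffel_symm (hG : IsMetricNear G y) (u v w : E) :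
    fderiv ℝ (christoffelCLM G) y u v w = fderiv ℝ (christoffelCLM G) y u w v := by
  rw [← hG.fderiv_christoffel, ← hG.fderiv_christoffel]
  have : (fun x => christoffel G x v w) =ᶠ[𝓝 y] fun x => christoffel G x w v :=
    hG.eventually.mono fun x hx => hx.christoffel_symm v w
  rw [this.fderiv_eq]

omit [FiniteDimensional ℝ E] in
theorem IsMetricNear.christoffelCLM_symm (hG : IsMetricNear G y) (v w : E) :
    christoffelCLM G y v w = christoffelCLM G y w v := by
  rw [christoffelCLM_apply, christoffelCLM_apply, hG.christoffel_symm]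

theorem IsMetricNear.riemannEndo_bianchi (hG : IsMetricNear G y) (u v w : E) :
    riemannEndo G y u v w + riemannEndo G y v w u + riemannEndo G y w u v = 0 := by
  simp only [hG.riemannEndo_eq]
  rw [hG.christoffelCLM_symm v w, hG.christoffelCLM_symm u w, hG.christoffelCLM_symm u v,
    hG.fderiv_christoffel_symm u v w, hG.fderiv_christoffel_symm v u w,
    hG.fderiv_christoffel_symm w u v]
  abel

/-- Differentiating ∇G = 0 once more expresses the second derivatives of `G` through Γ and its
derivative; their symmetry is the skewness of R(u, v) with respect to `G`. -/
theorem IsMetricNear.riemannForm_antisymm_right (hG : IsMetricNear G y) (u v w z : E) :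
    riemannForm G y u v w z = -riemannForm G y u v z w := by
  have key : ∀ t s : E, fderiv ℝ (fderiv ℝ G) y t s w z =
      fderiv ℝ G y t (christoffelCLM G y s w) z + G y (fderiv ℝ (christoffelCLM G) y t s w) z +
      (fderiv ℝ G y t w (christoffelCLM G y s z) +
        G y w (fderiv ℝ (christoffelCLM G) y t s z)) := by
    intro t s
    have hd : DifferentiableAt ℝ (fderiv ℝ G) y := hG.contDiffAt_fderiv.differentiableAt (by simp)
    have h0 : HasFDerivAt (fun x => fderiv ℝ G x s) ((fderiv ℝ (fderiv ℝ G) y).flip s) y := by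
      simpa using hd.hasFDerivAt.clm_apply (hasFDerivAt_const s y)
    have h1 := (hasFDerivAt_apply₂ h0 (hasFDerivAt_const w y) (hasFDerivAt_const z y) t).2
    have hΓ : ∀ r, HasFDerivAt (fun x => christoffelCLM G x s r)
        (((fderiv ℝ (christoffelCLM G) y).flip s).flip r) y := by
      intro r
      have := (hG.hasFDerivAt_christoffel.clm_apply (hasFDerivAt_const s y)).clm_apply
        (hasFDerivAt_const r y)
      simpa using this
    have h2 := hasFDerivAt_apply₂ hG.differentiableAt.hasFDerivAt (hΓ w) (hasFDerivAt_const z y) t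
    have h3 := hasFDerivAt_apply₂ hG.differentiableAt.hasFDerivAt (hasFDerivAt_const w y) (hΓ z) t
    -- Compatibility is needed on a whole neighbourhood, since both sides are about to be
    -- differentiated.
    have h4 : (fun x => fderiv ℝ G x s w z) =ᶠ[𝓝 y]
        (fun x => G x (christoffelCLM G x s w) z) + fun x => G x w (christoffelCLM G x s z) :=
      hG.eventually.mono fun x hx => by
        simp only [Pi.add_apply, christoffelCLM_apply]
        exact hx.fderiv_eq_christoffel s w z
    rw [h4.fderiv_eq, fderiv_add h2.1 h3.1, add_apply, h2.2, h3.2] at h1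
    simp at h1
    linarith
  have hsymm : fderiv ℝ (fderiv ℝ G) y u v = fderiv ℝ (fderiv ℝ G) y v u :=
    (hG.smooth.self_of_nhds.isSymmSndFDerivAt minSmoothness_two_le_infty) u v
  have h1 := key u v
  have h2 := key v u
  rw [hsymm, h2] at h1
  simp only [hG.fderiv_eq_christoffel, ← christoffelCLM_apply] at h1
  rw [riemannForm, riemannForm, hG.symm.self_of_nhds (riemannEndo G y u v z) w, hG.riemannEndo_eq,
    hG.riemannEndo_eq]
  simp only [map_add, map_sub, add_apply, sub_apply]
  linarith

theorem IsMetricNear.isAlgCurvatureTensor (hG : IsMetricNear G y) :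
    IsAlgCurvatureTensor (riemannForm G y) := by
  have hanti : ∀ v w x z, riemannForm G y v w x z = -riemannForm G y w v x z := by
    intro v w x z
    simp only [riemannForm, hG.riemannEndo_eq, map_add, map_sub, add_apply, sub_apply]
    ring
  have hbian : ∀ v w x z, riemannForm G y v w x z + riemannForm G y w x v z +
      riemannForm G y x v w z = 0 := by
    intro v w x z
    have := congrArg (fun t => G y t z) (hG.riemannEndo_bianchi v w x)
    simpa [riemannForm] using this
  refine ⟨?_, ?_, hanti, ?_, hbian⟩
  · intro u v w x z
    simp only [riemannForm, hG.riemannEndo_eq, map_add, map_sub, add_apply, sub_apply]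
    ring
  · intro c v w x z
    simp only [riemannForm, hG.riemannEndo_eq, map_add, map_sub, map_smul, add_apply, sub_apply,
      smul_apply, smul_eq_mul]
    ring
  · intro v w x z
    -- Pair symmetry is the usual combination of four Bianchi identities, the skew symmetries
    -- cancelling all other terms.
    have hr := hG.riemannForm_antisymm_right
    linarith [hbian v w x z, hbian w x z v, hbian x z v w, hbian z v w x, hanti v w x z,
      hanti w x v z, hanti x v w z, hanti w x z v, hanti x z w v, hanti z w x v, hanti x z v w,
      hanti z v x w, hanti v x z w, hanti z v w x, hanti v w z x, hanti w z v x,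
      hr v w x z, hr w x v z, hr x v w z, hr w x z v, hr x z w v, hr z w x v, hr x z v w,
      hr z v x w, hr v x z w, hr z v w x, hr v w z x, hr w z v x, hr w v x z, hr x w v z]

/-! ### Transformation law -/

variable {G' : E → E →L[ℝ] E →L[ℝ] ℝ} {φ : E → E}

omit [FiniteDimensional ℝ E] in
-- The second derivative of φ is the inhomogeneous term in the transformation law of a connection.
-- It appears on differentiating G' = φ*G and inserting the result in the Koszul formula;
-- surjectivity of dφ allows testing against vectors dφ(w) only.
theorem christoffel_pullback (hG : IsMetricNear G (φ y)) (hG' : IsMetricNear G' y)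
    (hφ : ContDiffAt ℝ ∞ φ y) (hsurj : Function.Surjective (fderiv ℝ φ y))
    (hpull : ∀ᶠ x in 𝓝 y, ∀ u v, G' x u v = G (φ x) (fderiv ℝ φ x u) (fderiv ℝ φ x v)) (u v : E) :
    fderiv ℝ φ y (christoffelCLM G' y u v) =
      christoffelCLM G (φ y) (fderiv ℝ φ y u) (fderiv ℝ φ y v) + fderiv ℝ (fderiv ℝ φ) y u v := by
  have hA : DifferentiableAt ℝ (fderiv ℝ φ) y :=
    (hφ.fderiv_right (m := ∞) (by simp)).differentiableAt (by simp)
  have hφ' : HasFDerivAt φ (fderiv ℝ φ y) y := (hφ.differentiableAt (by simp)).hasFDerivAt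
  have hsymm : ∀ a b, fderiv ℝ (fderiv ℝ φ) y a b = fderiv ℝ (fderiv ℝ φ) y b a :=
    hφ.isSymmSndFDerivAt minSmoothness_two_le_infty
  have hD : ∀ a b c, fderiv ℝ G' y a b c =
      fderiv ℝ G (φ y) (fderiv ℝ φ y a) (fderiv ℝ φ y b) (fderiv ℝ φ y c) +
      G (φ y) (fderiv ℝ (fderiv ℝ φ) y a b) (fderiv ℝ φ y c) +
      G (φ y) (fderiv ℝ φ y b) (fderiv ℝ (fderiv ℝ φ) y a c) := by
    intro a b c
    have h1 := (hasFDerivAt_apply₂ hG'.differentiableAt.hasFDerivAt (hasFDerivAt_const b y)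
      (hasFDerivAt_const c y) a).2
    have hAb : ∀ b, HasFDerivAt (fun x => fderiv ℝ φ x b) ((fderiv ℝ (fderiv ℝ φ) y).flip b) y := by
      intro b
      simpa using hA.hasFDerivAt.clm_apply (hasFDerivAt_const b y)
    have h2 := (hasFDerivAt_apply₂ (hG.differentiableAt.hasFDerivAt.comp y hφ') (hAb b) (hAb c) a).2
    have h3 : (fun x => G' x b c) =ᶠ[𝓝 y]
        fun x => (G ∘ φ) x (fderiv ℝ φ x b) (fderiv ℝ φ x c) := hpull.mono fun x hx => hx b c
    rw [h3.fderiv_eq, h2] at h1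
    simpa using h1.symm
  refine hG.eq_of_apply_eq fun w' => ?_
  obtain ⟨w, rfl⟩ := hsurj w'
  rw [← hpull.self_of_nhds, christoffelCLM_apply, hG'.apply_christoffel, christoffelLower_apply,
    map_add, add_apply, christoffelCLM_apply, hG.apply_christoffel, christoffelLower_apply, hD, hD,
    hD, hsymm v u, hsymm w u, hsymm w v, hG.symm.self_of_nhds _ (fderiv ℝ φ y v)]
  rw [hG.symm.self_of_nhds (fderiv ℝ φ y u)]
  ring

/-- Differentiating the transformation law of Γ produces second and third derivatives of φ;
antisymmetrization in u and v removes them because they are symmetric, so curvature is a tensor. -/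
theorem riemannForm_pullback (hG : IsMetricNear G (φ y)) (hG' : IsMetricNear G' y)
    (hφ : ∀ᶠ x in 𝓝 y, ContDiffAt ℝ ∞ φ x)
    (hsurj : ∀ᶠ x in 𝓝 y, Function.Surjective (fderiv ℝ φ x))
    (hpull : ∀ᶠ x in 𝓝 y, ∀ u v, G' x u v = G (φ x) (fderiv ℝ φ x u) (fderiv ℝ φ x v))
    (u v w z : E) :
    riemannForm G' y u v w z = riemannForm G (φ y) (fderiv ℝ φ y u) (fderiv ℝ φ y v)
      (fderiv ℝ φ y w) (fderiv ℝ φ y z) := by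
  have hφy := hφ.self_of_nhds
  have hA2 : ContDiffAt ℝ ∞ (fderiv ℝ φ) y := hφy.fderiv_right (by simp)
  have hA : DifferentiableAt ℝ (fderiv ℝ φ) y := hA2.differentiableAt (by simp)
  have hAA : DifferentiableAt ℝ (fderiv ℝ (fderiv ℝ φ)) y :=
    (hA2.fderiv_right (m := ∞) (by simp)).differentiableAt (by simp)
  have hφ' : HasFDerivAt φ (fderiv ℝ φ y) y := (hφy.differentiableAt (by simp)).hasFDerivAt
  have hsymm2 : ∀ a b, fderiv ℝ (fderiv ℝ φ) y a b = fderiv ℝ (fderiv ℝ φ) y b a :=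
    hφy.isSymmSndFDerivAt minSmoothness_two_le_infty
  have hsymm3 : ∀ a b, fderiv ℝ (fderiv ℝ (fderiv ℝ φ)) y a b =
      fderiv ℝ (fderiv ℝ (fderiv ℝ φ)) y b a :=
    hA2.isSymmSndFDerivAt minSmoothness_two_le_infty
  have hΓ : ∀ᶠ x in 𝓝 y, ∀ a b, fderiv ℝ φ x (christoffelCLM G' x a b) =
      christoffelCLM G (φ x) (fderiv ℝ φ x a) (fderiv ℝ φ x b) + fderiv ℝ (fderiv ℝ φ) x a b := by
    filter_upwards [hφ'.continuousAt.eventually hG.eventually, hG'.eventually, hφ, hsurj,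
      hpull.eventually_nhds] with x h1 h2 h3 h4 h5 a b using christoffel_pullback h1 h2 h3 h4 h5 a b
  have hAb : ∀ b, HasFDerivAt (fun x => fderiv ℝ φ x b) ((fderiv ℝ (fderiv ℝ φ) y).flip b) y := by
    intro b
    simpa using hA.hasFDerivAt.clm_apply (hasFDerivAt_const b y)
  have hΓ' : ∀ a b, HasFDerivAt (fun x => christoffelCLM G' x a b)
      (((fderiv ℝ (christoffelCLM G') y).flip a).flip b) y := by
    intro a b
    simpa using (hG'.hasFDerivAt_christoffel.clm_apply (hasFDerivAt_const a y)).clm_apply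
      (hasFDerivAt_const b y)
  -- The transformation law of Γ, differentiated at `y` in the direction `t`.
  have key : ∀ t a b, fderiv ℝ (fderiv ℝ φ) y t (christoffelCLM G' y a b) +
      fderiv ℝ φ y (fderiv ℝ (christoffelCLM G') y t a b) =
      fderiv ℝ (christoffelCLM G) (φ y) (fderiv ℝ φ y t) (fderiv ℝ φ y a) (fderiv ℝ φ y b) +
      christoffelCLM G (φ y) (fderiv ℝ (fderiv ℝ φ) y t a) (fderiv ℝ φ y b) +
      christoffelCLM G (φ y) (fderiv ℝ φ y a) (fderiv ℝ (fderiv ℝ φ) y t b) +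
      fderiv ℝ (fderiv ℝ (fderiv ℝ φ)) y t a b := by
    intro t a b
    have h1 := fderiv_clm_apply_apply hA.hasFDerivAt (hΓ' a b) t
    have h2 := hasFDerivAt_apply₂ (hG.hasFDerivAt_christoffel.comp y hφ') (hAb a) (hAb b) t
    have h3 := hasFDerivAt_apply₂ hAA.hasFDerivAt (hasFDerivAt_const a y) (hasFDerivAt_const b y) t
    have h4 : (fun x => fderiv ℝ φ x (christoffelCLM G' x a b)) =ᶠ[𝓝 y]
        (fun x => (christoffelCLM G ∘ φ) x (fderiv ℝ φ x a) (fderiv ℝ φ x b)) +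
          fun x => fderiv ℝ (fderiv ℝ φ) x a b := hΓ.mono fun x hx => hx a b
    have h5 := h4.fderiv_eq (𝕜 := ℝ)
    rw [fderiv_add h2.1 h3.1] at h5
    have h6 := congrArg (fun L : E →L[ℝ] E => L t) h5
    rw [add_apply, h1, h2.2, h3.2] at h6
    simp only [zero_apply, map_zero, add_zero, Function.comp_apply,
      ContinuousLinearMap.comp_apply, ContinuousLinearMap.flip_apply] at h6
    exact h6
  have hfin : fderiv ℝ φ y (riemannEndo G' y u v w) =
      riemannEndo G (φ y) (fderiv ℝ φ y u) (fderiv ℝ φ y v) (fderiv ℝ φ y w) := by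
    have k1 := key u v w
    have k2 := key v u w
    rw [← eq_sub_iff_add_eq'] at k1 k2
    have hΓy := hΓ.self_of_nhds
    rw [hG.riemannEndo_eq, hG'.riemannEndo_eq]
    simp only [map_add, map_sub, hΓy, k1, k2]
    rw [hsymm3 v u, hsymm2 v u]
    abel
  rw [riemannForm, riemannForm, hpull.self_of_nhds, hfin]

end CoordinateCurvature

/-! ### Passage from charts to the manifold -/

section ManifoldCurvature

variable {M : Type*} [TopologicalSpace M] [ChartedSpace E4 M] [IsManifold (𝓡 4) ∞ M]

/-- The coordinate vector fields of the chart at `c`. -/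
def chartFrame (c q : M) : E4 →L[ℝ] TangentSpace (𝓡 4) q :=
  (trivializationAt E4 (TangentSpace (𝓡 4) : M → Type _) c).symmL ℝ q

/-- The coordinates of tangent vectors in the chart at `c`. -/
def chartCoord (c q : M) : TangentSpace (𝓡 4) q →L[ℝ] E4 :=
  (trivializationAt E4 (TangentSpace (𝓡 4) : M → Type _) c).continuousLinearMapAt ℝ q

variable {c q : M}

theorem chartFrame_chartCoord (hq : q ∈ (chartAt E4 c).source) (v : TangentSpace (𝓡 4) q) :
    chartFrame c q (chartCoord c q v) = v :=
  Bundle.Trivialization.symmL_continuousLinearMapAt _ hq v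

theorem chartCoord_chartFrame (hq : q ∈ (chartAt E4 c).source) (v : E4) :
    chartCoord c q (chartFrame c q v) = v :=
  Bundle.Trivialization.continuousLinearMapAt_symmL _ hq v

theorem mfderiv_extChartAt_eq (hq : q ∈ (chartAt E4 c).source) :
    (mfderiv (𝓡 4) 𝓘(ℝ, E4) (extChartAt (𝓡 4) c) q : TangentSpace (𝓡 4) q →L[ℝ] E4) =
      chartCoord c q :=
  (TangentBundle.continuousLinearMapAt_trivializationAt hq).symm

theorem mfderiv_extChartAt_symm_eq {y : E4} (hy : y ∈ (extChartAt (𝓡 4) c).target) :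
    (mfderiv 𝓘(ℝ, E4) (𝓡 4) (extChartAt (𝓡 4) c).symm y :
      E4 →L[ℝ] TangentSpace (𝓡 4) ((extChartAt (𝓡 4) c).symm y)) =
      chartFrame c ((extChartAt (𝓡 4) c).symm y) := by
  have hq : (extChartAt (𝓡 4) c).symm y ∈ (chartAt E4 c).source := by
    rw [← extChartAt_source (𝓡 4)]
    exact (extChartAt (𝓡 4) c).map_target hy
  have h := TangentBundle.symmL_trivializationAt (I := 𝓡 4) hq
  -- The base point occurs in the type of the tangent space. Viewing all tangent spaces as `E4`
  -- makes the derivative an ordinary function of the point, in which `right_inv` can be rewritten.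
  let F : E4 → (E4 →L[ℝ] E4) := fun z =>
    mfderivWithin 𝓘(ℝ, E4) (𝓡 4) (extChartAt (𝓡 4) c).symm (Set.range (𝓡 4)) z
  have h' : (chartFrame c ((extChartAt (𝓡 4) c).symm y) : E4 →L[ℝ] E4) =
      F (extChartAt (𝓡 4) c ((extChartAt (𝓡 4) c).symm y)) := h
  rw [(extChartAt (𝓡 4) c).right_inv hy] at h'
  rw [← mfderivWithin_univ, ← ModelWithCorners.range_eq_univ (𝓡 4)]
  exact h'.symm

theorem LorentzianMetric.inChart_extChartAt (g : LorentzianMetric M)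
    (hq : q ∈ (chartAt E4 c).source) (u v : E4) :
    g.inChart c (extChartAt (𝓡 4) c q) u v = g.inner q (chartFrame c q u) (chartFrame c q v) := by
  have hq' : q ∈ (extChartAt (𝓡 4) c).source := by rwa [extChartAt_source]
  let F : M → ℝ := fun q => g.inner q (chartFrame c q u) (chartFrame c q v)
  have h : g.inChart c (extChartAt (𝓡 4) c q) u v =
      F ((extChartAt (𝓡 4) c).symm (extChartAt (𝓡 4) c q)) := by
    rw [LorentzianMetric.inChart_apply, mfderiv_extChartAt_symm_eq
      ((extChartAt (𝓡 4) c).map_source hq')]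
    rfl
  rw [h, (extChartAt (𝓡 4) c).left_inv hq']

theorem contMDiffOn_chartFrame (c : M) (u : E4) :
    ContMDiffOn (𝓡 4) (𝓡 4).tangent ∞
      (fun q => (⟨q, chartFrame c q u⟩ : TangentBundle (𝓡 4) M)) (chartAt E4 c).source := by
  have := (Bundle.Trivialization.contMDiffOn_section_baseSet_iff (IB := 𝓡 4) (n := ∞)
    (trivializationAt E4 (TangentSpace (𝓡 4) : M → Type _) c)
    (s := fun q => chartFrame c q u)).2 ?_
  · exact this
  · refine (contMDiffOn_const (c := u)).congr fun q hq => ?_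
    have := chartCoord_chartFrame (c := c) (q := q) hq u
    rwa [chartCoord, Bundle.Trivialization.continuousLinearMapAt_apply_of_mem _ _ hq] at this

theorem LorentzianMetric.contDiffOn_inChart (g : LorentzianMetric M) (c : M) :
    ContDiffOn ℝ ∞ (g.inChart c) (extChartAt (𝓡 4) c).target := by
  rw [contDiffOn_clm_apply]
  intro u
  rw [contDiffOn_clm_apply]
  intro v
  have h1 : ContMDiffOn (𝓡 4) ((𝓡 4).prod 𝓘(ℝ, ℝ)) ∞
      (fun q => Bundle.TotalSpace.mk' ℝ (E := Bundle.Trivial M ℝ) q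
        (g.inner q (chartFrame c q u) (chartFrame c q v))) (chartAt E4 c).source :=
    ContMDiffOn.clm_bundle_apply₂ (F₁ := E4) (F₂ := E4) g.contMDiff.contMDiffOn
      (contMDiffOn_chartFrame c u) (contMDiffOn_chartFrame c v)
  have h2 : ContMDiffOn (𝓡 4) 𝓘(ℝ, ℝ) ∞
      (fun q => g.inner q (chartFrame c q u) (chartFrame c q v)) (chartAt E4 c).source := by
    intro q hq
    exact (Bundle.contMDiffWithinAt_totalSpace.1 (h1 q hq)).2
  have h3 := h2.comp (contMDiffOn_extChartAt_symm (I := 𝓡 4) (n := ∞) c) (fun y hy => by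
    rw [← extChartAt_source (𝓡 4)]
    exact (extChartAt (𝓡 4) c).map_target hy)
  rw [contMDiffOn_iff_contDiffOn] at h3
  refine h3.congr fun y hy => ?_
  rw [LorentzianMetric.inChart_apply, mfderiv_extChartAt_symm_eq hy]
  rfl

omit [IsManifold (𝓡 4) ∞ M] in
theorem finrank_tangentSpace (q : M) : finrank ℝ (TangentSpace (𝓡 4) q) = 4 :=
  finrank_euclideanSpace_fin (𝕜 := ℝ) (n := 4)

theorem LorentzianMetric.exists_basis (g : LorentzianMetric M) (q : M) :
    ∃ b : Basis (Fin 4) ℝ (TangentSpace (𝓡 4) q),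
      ∀ i j, g.inner q (b i) (b j) = if i = j then (if i = 0 then -1 else 1) else 0 := by
  obtain ⟨e, he⟩ := g.signature q
  have hli : LinearIndependent ℝ e := by
    rw [Fintype.linearIndependent_iff]
    intro a ha i
    have h := congrArg (fun v => g.inner q v (e i)) ha
    simp only [map_sum, map_smul, sum_apply, smul_apply, he, map_zero, zero_apply] at h
    simp at h
    split_ifs at h <;> simpa using h
  refine ⟨basisOfLinearIndependentOfCardEqFinrank hli (by simp [finrank_tangentSpace]), ?_⟩
  simpa using he

theorem LorentzianMetric.nondegenerate (g : LorentzianMetric M) (q : M) (v : TangentSpace (𝓡 4) q)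
    (hv : ∀ w, g.inner q v w = 0) : v = 0 := by
  obtain ⟨b, hb⟩ := g.exists_basis q
  rw [← b.sum_repr v]
  refine Finset.sum_eq_zero fun i _ => ?_
  have h := hv (b i)
  rw [← b.sum_repr v] at h
  simp only [map_sum, map_smul, sum_apply, smul_apply, hb] at h
  simp at h
  split_ifs at h <;> simp_all

theorem LorentzianMetric.isMetricNear_inChart (g : LorentzianMetric M) {y : E4}
    (hy : y ∈ (extChartAt (𝓡 4) c).target) : IsMetricNear (g.inChart c) y := by
  have hn : ∀ᶠ x in 𝓝 y, x ∈ (extChartAt (𝓡 4) c).target :=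
    (isOpen_extChartAt_target c).mem_nhds hy
  refine ⟨?_, ?_, ?_⟩
  · filter_upwards [hn] with x hx
    exact (g.contDiffOn_inChart c).contDiffAt ((isOpen_extChartAt_target c).mem_nhds hx)
  · filter_upwards with x u v
    rw [LorentzianMetric.inChart_apply, LorentzianMetric.inChart_apply, g.symm]
  · filter_upwards [hn] with x hx
    obtain ⟨q, hq, rfl⟩ : ∃ q ∈ (chartAt E4 c).source, extChartAt (𝓡 4) c q = x :=
      ⟨(extChartAt (𝓡 4) c).symm x, by
        rw [← extChartAt_source (𝓡 4)]; exact (extChartAt (𝓡 4) c).map_target hx,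
        (extChartAt (𝓡 4) c).right_inv hx⟩
    have hinj : Function.Injective (g.inChart c (extChartAt (𝓡 4) c q)) := by
      rw [injective_iff_map_eq_zero]
      intro u hu
      have h0 : chartFrame c q u = 0 := by
        apply g.nondegenerate
        intro w
        rw [← chartFrame_chartCoord hq w, ← g.inChart_extChartAt hq, hu]
        rfl
      rw [← chartCoord_chartFrame hq u, h0, map_zero]
    have hfr : finrank ℝ E4 = finrank ℝ (E4 →L[ℝ] ℝ) := by
      rw [← (LinearMap.toContinuousLinearMap (𝕜 := ℝ) (E := E4) (F' := ℝ)).finrank_eq,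
        Module.finrank_linearMap, finrank_self, mul_one]
    let L := LinearEquiv.ofInjectiveOfFinrankEq
      (g.inChart c (extChartAt (𝓡 4) c q) : E4 →ₗ[ℝ] E4 →L[ℝ] ℝ) hinj hfr
    exact ⟨L.toContinuousLinearEquiv, by ext u v; rfl⟩

/-- Coordinate changes are expressed through the chart frames, in which the metrics in both charts
are known. -/
theorem fderiv_transition {p : M} (hq : q ∈ (chartAt E4 c).source)
    (hqp : q ∈ (chartAt E4 p).source) :
    fderiv ℝ (extChartAt (𝓡 4) c ∘ (extChartAt (𝓡 4) p).symm) (extChartAt (𝓡 4) p q) =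
      (chartCoord c q).comp (chartFrame p q) := by
  have hq' : q ∈ (extChartAt (𝓡 4) p).source := by rwa [extChartAt_source]
  have hy := (extChartAt (𝓡 4) p).map_source hq'
  have hinv := (extChartAt (𝓡 4) p).left_inv hq'
  have h1 : MDifferentiableAt 𝓘(ℝ, E4) (𝓡 4) (extChartAt (𝓡 4) p).symm (extChartAt (𝓡 4) p q) :=
    (mdifferentiableOn_extChartAt_symm _ hy).mdifferentiableAt
      ((isOpen_extChartAt_target p).mem_nhds hy)
  have h2 : MDifferentiableAt (𝓡 4) 𝓘(ℝ, E4) (extChartAt (𝓡 4) c)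
      ((extChartAt (𝓡 4) p).symm (extChartAt (𝓡 4) p q)) := by
    rw [hinv]
    exact mdifferentiableAt_extChartAt hq
  let F : M → (E4 →L[ℝ] E4) := fun q => (chartCoord c q).comp (chartFrame p q)
  have h3 : fderiv ℝ (extChartAt (𝓡 4) c ∘ (extChartAt (𝓡 4) p).symm) (extChartAt (𝓡 4) p q) =
      F ((extChartAt (𝓡 4) p).symm (extChartAt (𝓡 4) p q)) := by
    rw [← mfderiv_eq_fderiv, mfderiv_comp _ h2 h1]
    rw [mfderiv_extChartAt_symm_eq hy, mfderiv_extChartAt_eq (by rwa [hinv])]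
    rfl
  rw [h3, hinv]

theorem LorentzianMetric.riemannInChart_eq (g : LorentzianMetric M)
    (hq : q ∈ (chartAt E4 c).source) (u v w z : TangentSpace (𝓡 4) q) :
    g.riemannInChart c q u v w z = riemannForm (g.inChart c) (extChartAt (𝓡 4) c q)
      (chartCoord c q u) (chartCoord c q v) (chartCoord c q w) (chartCoord c q z) := by
  simp only [LorentzianMetric.riemannInChart]
  rw [mfderiv_extChartAt_eq hq]

/-- The tensor at p is defined in the chart centred at p, which moves with p; smooth dependence on p
can only be seen in one fixed chart. The comparison is `riemannForm_pullback` for the transition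
map. -/
theorem LorentzianMetric.riemannInChart_eq_riemann (g : LorentzianMetric M) {p : M}
    (hp : p ∈ (chartAt E4 c).source) (u v w z : TangentSpace (𝓡 4) p) :
    g.riemannInChart c p u v w z = g.riemann p u v w z := by
  have hpp : p ∈ (chartAt E4 p).source := mem_chart_source E4 p
  have hpp' : p ∈ (extChartAt (𝓡 4) p).source := mem_extChartAt_source p
  have hp' : p ∈ (extChartAt (𝓡 4) c).source := by rwa [extChartAt_source]
  rw [LorentzianMetric.riemann, g.riemannInChart_eq hp, g.riemannInChart_eq hpp]
  set y := extChartAt (𝓡 4) p p with hy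
  set φ := extChartAt (𝓡 4) c ∘ (extChartAt (𝓡 4) p).symm with hφ
  have hyt : y ∈ (extChartAt (𝓡 4) p).target := (extChartAt (𝓡 4) p).map_source hpp'
  have hφy : φ y = extChartAt (𝓡 4) c p := by
    simp only [hφ, hy, Function.comp_apply, (extChartAt (𝓡 4) p).left_inv hpp']
  have hnear : ∀ᶠ x in 𝓝 y, ∃ q, q ∈ (chartAt E4 c).source ∧ q ∈ (chartAt E4 p).source ∧
      extChartAt (𝓡 4) p q = x := by
    have h1 : ∀ᶠ x in 𝓝 y, x ∈ (extChartAt (𝓡 4) p).target :=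
      (isOpen_extChartAt_target p).mem_nhds hyt
    have h2 : ∀ᶠ x in 𝓝 y, (extChartAt (𝓡 4) p).symm x ∈ (chartAt E4 c).source := by
      apply (continuousAt_extChartAt_symm (I := 𝓡 4) p).eventually_mem
      rw [(extChartAt (𝓡 4) p).left_inv hpp']
      exact (chartAt E4 c).open_source.mem_nhds hp
    filter_upwards [h1, h2] with x hx1 hx2
    refine ⟨(extChartAt (𝓡 4) p).symm x, hx2, ?_, (extChartAt (𝓡 4) p).right_inv hx1⟩
    rw [← extChartAt_source (𝓡 4)]
    exact (extChartAt (𝓡 4) p).map_target hx1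
  have hφq : ∀ q ∈ (chartAt E4 p).source, φ (extChartAt (𝓡 4) p q) = extChartAt (𝓡 4) c q := by
    intro q hq
    rw [← extChartAt_source (𝓡 4)] at hq
    simp only [hφ, Function.comp_apply, (extChartAt (𝓡 4) p).left_inv hq]
  have hmain := riemannForm_pullback (G := g.inChart c) (G' := g.inChart p) (φ := φ) (y := y)
    (by rw [hφy]; exact g.isMetricNear_inChart ((extChartAt (𝓡 4) c).map_source hp'))
    (g.isMetricNear_inChart hyt) ?_ ?_ ?_ (chartCoord p p u) (chartCoord p p v)
    (chartCoord p p w) (chartCoord p p z)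
  · rw [hmain, hφy, hφ, hy, fderiv_transition hp hpp]
    simp only [ContinuousLinearMap.comp_apply, chartFrame_chartCoord hpp]
  · filter_upwards [hnear] with x hx
    obtain ⟨q, hqc, hqp, rfl⟩ := hx
    have hqp' : q ∈ (extChartAt (𝓡 4) p).source := by rwa [extChartAt_source]
    have h1 : ContMDiffAt 𝓘(ℝ, E4) (𝓡 4) ∞ (extChartAt (𝓡 4) p).symm (extChartAt (𝓡 4) p q) :=
      (contMDiffOn_extChartAt_symm p).contMDiffAt
        ((isOpen_extChartAt_target p).mem_nhds ((extChartAt (𝓡 4) p).map_source hqp'))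
    have h2 : ContMDiffAt (𝓡 4) 𝓘(ℝ, E4) ∞ (extChartAt (𝓡 4) c)
        ((extChartAt (𝓡 4) p).symm (extChartAt (𝓡 4) p q)) := by
      rw [(extChartAt (𝓡 4) p).left_inv hqp']
      exact contMDiffAt_extChartAt' hqc
    exact (h2.comp _ h1).contDiffAt
  · filter_upwards [hnear] with x hx
    obtain ⟨q, hqc, hqp, rfl⟩ := hx
    rw [hφ, fderiv_transition hqc hqp]
    intro v
    exact ⟨chartCoord p q (chartFrame c q v), by
      rw [ContinuousLinearMap.comp_apply, chartFrame_chartCoord hqp, chartCoord_chartFrame hqc]⟩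
  · filter_upwards [hnear] with x hx u v
    obtain ⟨q, hqc, hqp, rfl⟩ := hx
    rw [hφq q hqp, hφ, fderiv_transition hqc hqp, g.inChart_extChartAt hqp,
      g.inChart_extChartAt hqc]
    simp only [ContinuousLinearMap.comp_apply, chartFrame_chartCoord hqc]

theorem LorentzianMetric.isAlgCurvatureTensor_riemann (g : LorentzianMetric M) (p : M) :
    IsAlgCurvatureTensor (g.riemann p) := by
  have hp : p ∈ (chartAt E4 p).source := mem_chart_source E4 p
  have h := (g.isMetricNear_inChart (c := p)
    ((extChartAt (𝓡 4) p).map_source (mem_extChartAt_source p))).isAlgCurvatureTensor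
  have hR : g.riemann p = fun u v w z => riemannForm (g.inChart p) (extChartAt (𝓡 4) p p)
      (chartCoord p p u) (chartCoord p p v) (chartCoord p p w) (chartCoord p p z) := by
    funext u v w z
    exact g.riemannInChart_eq hp u v w z
  rw [hR]
  refine ⟨?_, ?_, ?_, ?_, ?_⟩
  · intro u v w x y
    simp only [map_add, h.add]
  · intro a v w x y
    simp only [map_smul, h.smul]
  · intro v w x y
    exact h.antisymm _ _ _ _
  · intro v w x y
    exact h.pairSymm _ _ _ _
  · intro v w x y
    exact h.bianchi _ _ _ _

end ManifoldCurvature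

/-! ### Two-vectors, the Hodge star and the curvature operator in an orthonormal frame -/

section TwoVectors

variable {V : Type*} [AddCommGroup V] [Module ℝ V]

theorem coe_wedge (v w : V) :
    (wedge v w : ExteriorAlgebra ℝ V) = ExteriorAlgebra.ι ℝ v * ExteriorAlgebra.ι ℝ w := by
  simp [wedge, ExteriorAlgebra.ιMulti_apply]

theorem wedge_add_left (v v' w : V) : wedge (v + v') w = wedge v w + wedge v' w := by
  apply Subtype.ext
  simp only [Submodule.coe_add, coe_wedge, map_add, add_mul]

theorem wedge_smul_left (c : ℝ) (v w : V) : wedge (c • v) w = c • wedge v w := by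
  apply Subtype.ext
  simp only [Submodule.coe_smul, coe_wedge, map_smul, smul_mul_assoc]

theorem wedge_self (v : V) : wedge v v = 0 := by
  apply Subtype.ext
  rw [coe_wedge, ExteriorAlgebra.ι_sq_zero]
  rfl

theorem wedge_add_right (v w w' : V) : wedge v (w + w') = wedge v w + wedge v w' := by
  apply Subtype.ext
  simp only [Submodule.coe_add, coe_wedge, map_add, mul_add]

theorem wedge_swap (v w : V) : wedge v w = -wedge w v := by
  have h := wedge_self (v + w)
  rw [wedge_add_left, wedge_add_right, wedge_add_right, wedge_self, wedge_self, zero_add,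
    add_zero] at h
  exact eq_neg_of_add_eq_zero_left h

theorem hom_ext_wedge {N : Type*} [AddCommGroup N] [Module ℝ N] {f g : ⋀[ℝ]^2 V →ₗ[ℝ] N}
    (h : ∀ v w, f (wedge v w) = g (wedge v w)) : f = g := by
  apply exteriorPower.linearMap_ext
  ext a
  have ha : a = ![a 0, a 1] := by
    ext i
    fin_cases i <;> rfl
  rw [ha]
  exact h (a 0) (a 1)

variable {h : LinearMap.BilinForm ℝ V}

theorem ip2_symm (hs : ∀ v w, h v w = h w v) (ξ η : ⋀[ℝ]^2 V) : ip2 h ξ η = ip2 h η ξ := by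
  have : ip2 h = LinearMap.flip (ip2 h) := by
    refine hom_ext_wedge fun v w => hom_ext_wedge fun x y => ?_
    rw [LinearMap.flip_apply, ip2_wedge, ip2_wedge, hs v x, hs w y, hs v y, hs w x]
    ring
  exact congrArg (fun B => B ξ η) this

variable {b : Basis (Fin 4) ℝ V}

theorem IsOrthonormalFrame.repr_eq (hb : IsOrthonormalFrame h b) (v : V) (i : Fin 4) :
    h (b i) v = b.repr v i := by
  conv_lhs => rw [← b.sum_repr v]
  simp [-Basis.sum_repr, hb (i : Fin 4) _]

theorem IsOrthonormalFrame.apply_eq_sum (hb : IsOrthonormalFrame h b) (v w : V) :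
    h v w = ∑ i, b.repr v i * b.repr w i := by
  conv_lhs => rw [← b.sum_repr v]
  simp [-Basis.sum_repr, hb.repr_eq]

theorem IsOrthonormalFrame.symm (hb : IsOrthonormalFrame h b) (v w : V) : h v w = h w v := by
  rw [hb.apply_eq_sum, hb.apply_eq_sum]
  simp only [mul_comm]

theorem IsOrthonormalFrame.ip2_framePlane (hb : IsOrthonormalFrame h b) (i j : Fin 3) :
    ip2 h (framePlane b i) (framePlane b j) = if i = j then 1 else 0 := by
  fin_cases i <;> fin_cases j <;> simp [framePlane, ip2_wedge, hb _ _]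

theorem IsOrthonormalFrame.ip2_framePlanePerp (hb : IsOrthonormalFrame h b) (i j : Fin 3) :
    ip2 h (framePlanePerp b i) (framePlanePerp b j) = if i = j then 1 else 0 := by
  fin_cases i <;> fin_cases j <;> simp [framePlanePerp, ip2_wedge, hb _ _]

theorem IsOrthonormalFrame.ip2_framePlane_framePlanePerp (hb : IsOrthonormalFrame h b)
    (i j : Fin 3) : ip2 h (framePlane b i) (framePlanePerp b j) = 0 := by
  fin_cases i <;> fin_cases j <;> simp [framePlane, framePlanePerp, ip2_wedge, hb _ _]

theorem IsOrthonormalFrame.ip2_framePlanePerp_framePlane (hb : IsOrthonormalFrame h b)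
    (i j : Fin 3) : ip2 h (framePlanePerp b i) (framePlane b j) = 0 := by
  rw [ip2_symm hb.symm, hb.ip2_framePlane_framePlanePerp]

/-- The values of an alternating form on the planes `e₀ ∧ eᵢ`. -/
def onPlane {N : Type*} (B : V → V → N) (e : Fin 4 → V) : Fin 3 → N :=
  ![B (e 0) (e 1), B (e 0) (e 2), B (e 0) (e 3)]

/-- The values of an alternating form on the planes complementary to `e₀ ∧ eᵢ`. -/
def onPlanePerp {N : Type*} (B : V → V → N) (e : Fin 4 → V) : Fin 3 → N :=
  ![B (e 2) (e 3), B (e 3) (e 1), B (e 1) (e 2)]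

/-- Stated for arbitrary alternating bilinear maps, so as to apply to `wedge` itself, giving
coordinates on Λ², and to each pair of arguments of a curvature tensor, giving the operator R̂. -/
theorem IsOrthonormalFrame.alternating_expand (hb : IsOrthonormalFrame h b)
    {N : Type*} [AddCommGroup N] [Module ℝ N] {B : V → V → N}
    (hadd : ∀ u v w, B (u + v) w = B u w + B v w) (hsmul : ∀ (c : ℝ) v w, B (c • v) w = c • B v w)
    (hanti : ∀ v w, B v w = -B w v) (v w : V) :
    B v w = ∑ k, (ip2 h (framePlane b k) (wedge v w) • onPlane B b k +
      ip2 h (framePlanePerp b k) (wedge v w) • onPlanePerp B b k) := by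
  have hadd' : ∀ u v w, B w (u + v) = B w u + B w v := by
    intro u v w
    rw [hanti, hadd, hanti u, hanti v]
    abel
  have hsmul' : ∀ (c : ℝ) v w, B w (c • v) = c • B w v := by
    intro c v w
    rw [hanti, hsmul, hanti v, smul_neg, neg_neg]
  have hself : ∀ v, B v v = 0 := fun v => by
    have h2 : (2 : ℝ) • B v v = 0 := by
      rw [two_smul]
      nth_rewrite 1 [hanti]
      exact neg_add_cancel _
    simpa using h2
  conv_lhs => rw [← b.sum_repr v, ← b.sum_repr w]
  simp only [Fin.sum_univ_four, Fin.sum_univ_three, hadd, hadd', hsmul, hsmul', hself, smul_zero,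
    framePlane, framePlanePerp, onPlane, onPlanePerp, Matrix.cons_val, ip2_wedge, hb.repr_eq]
  rw [hanti (b 1) (b 0), hanti (b 2) (b 0), hanti (b 3) (b 0), hanti (b 3) (b 2),
    hanti (b 1) (b 3), hanti (b 2) (b 1)]
  module

theorem framePlane_eq (e : Fin 4 → V) : framePlane e = onPlane wedge e := rfl

theorem framePlanePerp_eq (e : Fin 4 → V) : framePlanePerp e = onPlanePerp wedge e := rfl

theorem IsOrthonormalFrame.expand (hb : IsOrthonormalFrame h b) (ξ : ⋀[ℝ]^2 V) :
    ξ = ∑ k, (ip2 h (framePlane b k) ξ • framePlane b k +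
      ip2 h (framePlanePerp b k) ξ • framePlanePerp b k) := by
  have : LinearMap.id = ∑ k, ((ip2 h (framePlane b k)).smulRight (framePlane b k) +
      (ip2 h (framePlanePerp b k)).smulRight (framePlanePerp b k)) := by
    refine hom_ext_wedge fun v w => ?_
    have := hb.alternating_expand wedge_add_left wedge_smul_left wedge_swap v w
    simpa [← framePlane_eq, ← framePlanePerp_eq] using this
  have h2 := congrArg (fun f => f ξ) this
  simpa using h2

theorem IsOrthonormalFrame.ip2_ext (hb : IsOrthonormalFrame h b) {ξ η : ⋀[ℝ]^2 V}
    (h1 : ∀ v w, ip2 h ξ (wedge v w) = ip2 h η (wedge v w)) : ξ = η := by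
  have h2 : ip2 h ξ = ip2 h η := hom_ext_wedge h1
  rw [hb.expand ξ, hb.expand η]
  refine Finset.sum_congr rfl fun k _ => ?_
  rw [ip2_symm hb.symm _ ξ, ip2_symm hb.symm _ ξ, ip2_symm hb.symm _ η, ip2_symm hb.symm _ η, h2]

/-! ### The Hodge star -/

theorem ιMulti_eq_det_smul (b : Basis (Fin 4) ℝ V) (e : Fin 4 → V) :
    ExteriorAlgebra.ιMulti ℝ 4 e = b.det e • ExteriorAlgebra.ιMulti ℝ 4 b := by
  have : ExteriorAlgebra.ιMulti ℝ 4 =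
      (LinearMap.toSpanSingleton ℝ _ (ExteriorAlgebra.ιMulti ℝ 4 b)).compAlternatingMap b.det := by
    refine Basis.ext_alternating b fun v hv => ?_
    let σ : Equiv.Perm (Fin 4) := Equiv.ofBijective v (Finite.injective_iff_bijective.1 hv)
    have hσ : (fun i => b (v i)) = b ∘ σ := rfl
    rw [hσ, AlternatingMap.map_perm, AlternatingMap.map_perm]
    simp [Basis.det_self]
  conv_lhs => rw [this]
  simp

theorem ιMulti_basis_ne_zero (b : Basis (Fin 4) ℝ V) : ExteriorAlgebra.ιMulti ℝ 4 b ≠ 0 := by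
  intro h0
  -- A family of alternating forms, one in each degree, is a linear functional on the exterior
  -- algebra; with the determinant in degree 4 it takes the value 1 on the product of the basis.
  let f : ∀ i, V [⋀^Fin i]→ₗ[ℝ] ℝ := fun i => if hi : i = 4 then hi ▸ b.det else 0
  have h1 := ExteriorAlgebra.liftAlternating_apply_ιMulti f (⇑b)
  rw [h0, map_zero] at h1
  have : f 4 = b.det := rfl
  rw [this, Basis.det_self] at h1
  exact zero_ne_one h1

theorem wedge_mul_wedge (v w x y : V) :
    (wedge v w : ExteriorAlgebra ℝ V) * (wedge x y : ExteriorAlgebra ℝ V) =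
      ExteriorAlgebra.ιMulti ℝ 4 ![v, w, x, y] := by
  simp [coe_wedge, ExteriorAlgebra.ιMulti_apply, mul_assoc]

/-- The Hodge star operator written in the orthonormal frame `e`. -/
def frameStar (h : LinearMap.BilinForm ℝ V) (e : Fin 4 → V) : ⋀[ℝ]^2 V →ₗ[ℝ] ⋀[ℝ]^2 V :=
  ∑ k, ((ip2 h (framePlane e k)).smulRight (framePlanePerp e k) +
    (ip2 h (framePlanePerp e k)).smulRight (framePlane e k))

theorem frameStar_apply (e : Fin 4 → V) (ξ : ⋀[ℝ]^2 V) :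
    frameStar h e ξ = ∑ k, (ip2 h (framePlane e k) ξ • framePlanePerp e k +
      ip2 h (framePlanePerp e k) ξ • framePlane e k) := by
  simp [frameStar]

theorem IsOrthonormalFrame.frameStar_framePlane (hb : IsOrthonormalFrame h b) (k : Fin 3) :
    frameStar h b (framePlane b k) = framePlanePerp b k := by
  simp [frameStar_apply, hb.ip2_framePlane, hb.ip2_framePlanePerp_framePlane]

theorem IsOrthonormalFrame.frameStar_framePlanePerp (hb : IsOrthonormalFrame h b) (k : Fin 3) :
    frameStar h b (framePlanePerp b k) = framePlane b k := by
  simp [frameStar_apply, hb.ip2_framePlanePerp, hb.ip2_framePlane_framePlanePerp]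

theorem IsOrthonormalFrame.frameStar_frameStar (hb : IsOrthonormalFrame h b) (ξ : ⋀[ℝ]^2 V) :
    frameStar h b (frameStar h b ξ) = ξ := by
  conv_rhs => rw [hb.expand ξ]
  rw [frameStar_apply _ ξ]
  simp [map_sum, hb.frameStar_framePlane, hb.frameStar_framePlanePerp]

theorem IsOrthonormalFrame.ip2_frameStar (hb : IsOrthonormalFrame h b) (ξ η : ⋀[ℝ]^2 V) :
    ip2 h ξ (frameStar h b η) = ∑ k, (ip2 h (framePlane b k) ξ * ip2 h (framePlanePerp b k) η +
      ip2 h (framePlanePerp b k) ξ * ip2 h (framePlane b k) η) := by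
  rw [frameStar_apply, ip2_symm hb.symm ξ]
  simp only [map_sum, map_add, map_smul, LinearMap.sum_apply, LinearMap.add_apply,
    LinearMap.smul_apply, smul_eq_mul]
  exact Finset.sum_congr rfl fun k _ => by ring

/-- Laplace expansion by 2 × 2 minors: the inner products of decomposables with the frame planes are
these minors, and ⋆ pairs complementary ones. -/
theorem IsOrthonormalFrame.det_eq (hb : IsOrthonormalFrame h b) (v w x y : V) :
    b.det ![v, w, x, y] = ip2 h (wedge v w) (frameStar h b (wedge x y)) := by
  rw [hb.ip2_frameStar, Basis.det_apply, Matrix.det_succ_row_zero]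
  simp only [Fin.sum_univ_four, Fin.sum_univ_three, Matrix.det_fin_three, Matrix.submatrix_apply,
    Basis.toMatrix_apply, framePlane, framePlanePerp, Matrix.cons_val, ip2_wedge, hb.repr_eq]
  simp [Fin.succAbove, Fin.lt_def]
  ring

theorem IsOrthonormalFrame.mul_frameStar (hb : IsOrthonormalFrame h b) (ξ η : ⋀[ℝ]^2 V) :
    (ξ : ExteriorAlgebra ℝ V) * (frameStar h b η : ExteriorAlgebra ℝ V) =
      ip2 h ξ η • ExteriorAlgebra.ιMulti ℝ 4 b := by
  have key : ∀ ξ η : ⋀[ℝ]^2 V, (ξ : ExteriorAlgebra ℝ V) * (η : ExteriorAlgebra ℝ V) =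
      ip2 h ξ (frameStar h b η) • ExteriorAlgebra.ιMulti ℝ 4 b := by
    intro ξ η
    have : (LinearMap.mul ℝ (ExteriorAlgebra ℝ V)).compl₁₂ (⋀[ℝ]^2 V).subtype
        (⋀[ℝ]^2 V).subtype = ((ip2 h).compl₁₂ LinearMap.id (frameStar h b)).compr₂
          (LinearMap.toSpanSingleton ℝ _ (ExteriorAlgebra.ιMulti ℝ 4 b)) := by
      refine hom_ext_wedge fun v w => hom_ext_wedge fun x y => ?_
      simp only [LinearMap.compl₁₂_apply, LinearMap.compr₂_apply, Submodule.subtype_apply,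
        LinearMap.mul_apply_apply, LinearMap.id_apply, LinearMap.toSpanSingleton_apply]
      rw [wedge_mul_wedge, ιMulti_eq_det_smul b, hb.det_eq]
    simpa using congrArg (fun f => f ξ η) this
  rw [key, hb.frameStar_frameStar]

theorem IsOrthonormalFrame.isHodgeStar_frameStar {o : Orientation ℝ V (Fin 4)}
    (hb : IsOrthonormalFrame h b) (ho : b.orientation = o) : IsHodgeStar h o (frameStar h b) := by
  intro e he hpos ξ η
  obtain ⟨c, rfl, hc⟩ := hpos
  rw [hb.mul_frameStar, ιMulti_eq_det_smul b c]
  -- The change of frame is orthogonal with positive determinant, so the volume element is the same.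
  have hdet : b.det c = 1 := by
    have h1 : 0 < b.det c := by
      rw [← Basis.orientation_eq_iff_det_pos, ho, hc]
    have h2 : (b.toMatrix c).transpose * b.toMatrix c = 1 := by
      ext i j
      rw [Matrix.mul_apply]
      simp only [Matrix.transpose_apply, Basis.toMatrix_apply]
      rw [← hb.apply_eq_sum, he, Matrix.one_apply]
    have h3 := congrArg Matrix.det h2
    rw [Matrix.det_mul, Matrix.det_transpose, Matrix.det_one, ← Basis.det_apply] at h3
    nlinarith
  rw [hdet, one_smul]

/-- The defining property determines the star because `ip2 h` is nondegenerate, so the chosen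
operator is the explicit one of any positively oriented orthonormal basis. -/
theorem IsOrthonormalFrame.hodgeStar_eq {o : Orientation ℝ V (Fin 4)}
    (hb : IsOrthonormalFrame h b) (ho : b.orientation = o) : hodgeStar h o = frameStar h b := by
  have h1 : IsHodgeStar h o (hodgeStar h o) :=
    Classical.epsilon_spec ⟨_, hb.isHodgeStar_frameStar ho⟩
  have h2 := hb.isHodgeStar_frameStar ho
  refine LinearMap.ext fun η => ?_
  have h3 : ∀ ξ, ip2 h ξ (frameStar h b (hodgeStar h o η)) = ip2 h ξ η := by
    intro ξ
    have h4 := h1 b hb ⟨b, rfl, ho⟩ ξ η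
    rw [← hb.frameStar_frameStar (hodgeStar h o η), hb.mul_frameStar] at h4
    exact smul_left_injective ℝ (ιMulti_basis_ne_zero b) h4
  have h5 : frameStar h b (hodgeStar h o η) = η := by
    refine hb.ip2_ext fun v w => ?_
    rw [ip2_symm hb.symm, h3, ip2_symm hb.symm]
  rw [← h5, hb.frameStar_frameStar, h5]

/-! ### The curvature operator -/

variable {R : V → V → V → V → ℝ}

theorem IsAlgCurvatureTensor.antisymm_right (hR : IsAlgCurvatureTensor R) (v w x y : V) :
    R v w x y = -R v w y x := by
  rw [hR.pairSymm, hR.antisymm, hR.pairSymm y]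

theorem IsOrthonormalFrame.exists_isCurvatureOperator (hb : IsOrthonormalFrame h b)
    (hR : IsAlgCurvatureTensor R) : ∃ A, IsCurvatureOperator h R A := by
  -- With the last two arguments fixed, R becomes a linear functional on Λ²; R̂ is then assembled
  -- from its values on the six frame planes.
  have hex : ∀ x y, ∃ r : ⋀[ℝ]^2 V →ₗ[ℝ] ℝ, ∀ v w, r (wedge v w) = R v w x y := by
    intro x y
    refine ⟨∑ k, (onPlane (fun v w => R v w x y) b k • ip2 h (framePlane b k) +
      onPlanePerp (fun v w => R v w x y) b k • ip2 h (framePlanePerp b k)), fun v w => ?_⟩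
    have := hb.alternating_expand (B := fun v w => R v w x y) (fun u v w => hR.add u v w x y)
      (fun c v w => hR.smul c v w x y) (fun v w => hR.antisymm v w x y) v w
    rw [this]
    simp [mul_comm]
  choose r hr using hex
  refine ⟨-∑ k, ((onPlane r b k).smulRight (framePlane b k) +
    (onPlanePerp r b k).smulRight (framePlanePerp b k)), fun v w x y => ?_⟩
  have hP : ∀ k, onPlane r b k (wedge v w) = onPlane (R v w) b k := by
    intro k
    fin_cases k <;> simp [onPlane, hr]
  have hQ : ∀ k, onPlanePerp r b k (wedge v w) = onPlanePerp (R v w) b k := by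
    intro k
    fin_cases k <;> simp [onPlanePerp, hr]
  have h1 := hb.alternating_expand (B := R v w)
    (fun x x' y => by rw [hR.pairSymm, hR.add, hR.pairSymm x, hR.pairSymm x'])
    (fun c x y => by rw [hR.pairSymm, hR.smul, hR.pairSymm x]; rfl)
    (fun x y => hR.antisymm_right v w x y) x y
  rw [h1]
  simp [LinearMap.sum_apply, hP, hQ, mul_comm]

theorem IsOrthonormalFrame.isCurvatureOperator (hb : IsOrthonormalFrame h b)
    (hR : IsAlgCurvatureTensor R) : IsCurvatureOperator h R (curvatureOperator h R) :=
  Classical.epsilon_spec (hb.exists_isCurvatureOperator hR)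

theorem IsOrthonormalFrame.ip2_curvatureOperator_comm (hb : IsOrthonormalFrame h b)
    (hR : IsAlgCurvatureTensor R) (ξ η : ⋀[ℝ]^2 V) :
    ip2 h (curvatureOperator h R ξ) η = ip2 h ξ (curvatureOperator h R η) := by
  have hA := hb.isCurvatureOperator hR
  have : ip2 h ∘ₗ curvatureOperator h R =
      LinearMap.flip (ip2 h ∘ₗ curvatureOperator h R) := by
    refine hom_ext_wedge fun v w => hom_ext_wedge fun x y => ?_
    simp only [LinearMap.comp_apply, LinearMap.flip_apply]
    have h1 := hA v w x y
    have h2 := hA x y v w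
    rw [hR.pairSymm, h2] at h1
    linarith
  rw [ip2_symm hb.symm ξ]
  exact congrArg (fun B => B ξ η) this

end TwoVectors

/-! ### Commuting with the star as a condition on the trace -/

section EinsteinCondition

variable {V : Type*} [AddCommGroup V] [Module ℝ V] {h : LinearMap.BilinForm ℝ V}
  {b : Basis (Fin 4) ℝ V} {R : V → V → V → V → ℝ}

theorem IsAlgCurvatureTensor.add₄ (hR : IsAlgCurvatureTensor R) (u v w x y : V) :
    R w x y (u + v) = R w x y u + R w x y v := by
  rw [hR.antisymm_right, hR.pairSymm, hR.add, hR.antisymm_right w x y u, hR.pairSymm w x u,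
    hR.antisymm_right w x y v, hR.pairSymm w x v]
  ring

theorem IsAlgCurvatureTensor.smul₄ (hR : IsAlgCurvatureTensor R) (c : ℝ) (v w x y : V) :
    R w x y (c • v) = c * R w x y v := by
  rw [hR.antisymm_right, hR.pairSymm, hR.smul, hR.antisymm_right w x y v, hR.pairSymm w x v]
  ring

/-- The bilinear form `(x, y) ↦ R(x, v, w, y)`. -/
def IsAlgCurvatureTensor.outerForm (hR : IsAlgCurvatureTensor R) (v w : V) :
    LinearMap.BilinForm ℝ V :=
  LinearMap.mk₂ ℝ (fun x y => R x v w y) (fun _ _ _ => hR.add _ _ _ _ _)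
    (fun _ _ _ => hR.smul _ _ _ _ _) (fun _ _ _ => hR.add₄ _ _ _ _ _)
    (fun _ _ _ => hR.smul₄ _ _ _ _ _)

/-- The bilinear form `(v, w) ↦ ∑ R(eᵢ, v, w, eᵢ)`. -/
def IsAlgCurvatureTensor.ricciForm (hR : IsAlgCurvatureTensor R) (e : Fin 4 → V) :
    LinearMap.BilinForm ℝ V :=
  ∑ i, LinearMap.mk₂ ℝ (fun v w => R (e i) v w (e i))
    (fun _ _ _ => by
      rw [hR.antisymm, hR.add, hR.antisymm (e i), hR.antisymm (e i)]
      ring)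
    (fun _ _ _ => by
      rw [hR.antisymm, hR.smul, hR.antisymm (e i), smul_eq_mul]
      ring)
    (fun _ _ _ => by
      rw [hR.antisymm_right, hR.add₄, hR.antisymm_right _ _ _ (e i),
        hR.antisymm_right _ _ _ (e i)]
      ring)
    (fun _ _ _ => by
      rw [hR.antisymm_right, hR.smul₄, hR.antisymm_right _ _ _ (e i), smul_eq_mul]
      ring)

theorem IsAlgCurvatureTensor.ricciForm_apply (hR : IsAlgCurvatureTensor R) (e : Fin 4 → V)
    (v w : V) : hR.ricciForm e v w = ∑ i, R (e i) v w (e i) := by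
  simp [IsAlgCurvatureTensor.ricciForm, LinearMap.sum_apply]

theorem IsOrthonormalFrame.metricTrace_eq [FiniteDimensional ℝ V] (hb : IsOrthonormalFrame h b)
    (hR : IsAlgCurvatureTensor R) (v w : V) :
    metricTrace h R v w = ∑ i, R (b i) v w (b i) := by
  set c := finBasis ℝ V
  have hX : b.toMatrix c * c.toMatrix b = 1 := Basis.toMatrix_mul_toMatrix_flip b c
  have hY : c.toMatrix b * b.toMatrix c = 1 := Basis.toMatrix_mul_toMatrix_flip c b
  have hG : (Matrix.of fun k l => h (c k) (c l)) = (b.toMatrix c).transpose * b.toMatrix c := by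
    ext k l
    rw [Matrix.mul_apply, Matrix.of_apply, hb.apply_eq_sum]
    rfl
  -- The Gram matrix is XᵀX for the transition matrix X, so its inverse is YYᵀ with Y = X⁻¹.
  have hinv : (Matrix.of fun k l => h (c k) (c l))⁻¹ =
      c.toMatrix b * (c.toMatrix b).transpose := by
    apply Matrix.inv_eq_left_inv
    rw [hG, Matrix.mul_assoc, ← Matrix.mul_assoc (c.toMatrix b).transpose, ← Matrix.transpose_mul,
      hX, Matrix.transpose_one, Matrix.one_mul, hY]
  have hsum : ∀ a, R (b a) v w (b a) =
      ∑ i, ∑ j, c.toMatrix b i a * c.toMatrix b j a * R (c i) v w (c j) := by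
    intro a
    change hR.outerForm v w (b a) (b a) = _
    conv_lhs => rw [← c.sum_repr (b a)]
    simp only [map_sum, map_smul, LinearMap.sum_apply, LinearMap.smul_apply, smul_eq_mul,
      Finset.mul_sum]
    rw [Finset.sum_comm]
    refine Finset.sum_congr rfl fun i _ => Finset.sum_congr rfl fun j _ => ?_
    rw [← mul_assoc, mul_comm (c.repr (b a) j)]
    rfl
  rw [metricTrace]
  simp only [hsum]
  conv_rhs => rw [Finset.sum_comm]
  refine Finset.sum_congr rfl fun i _ => ?_
  conv_rhs => rw [Finset.sum_comm]
  refine Finset.sum_congr rfl fun j _ => ?_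
  rw [hinv, Matrix.mul_apply, Finset.sum_mul]
  rfl

theorem IsOrthonormalFrame.hom_ext (hb : IsOrthonormalFrame h b) {N : Type*} [AddCommGroup N]
    [Module ℝ N] {f g : ⋀[ℝ]^2 V →ₗ[ℝ] N} (h1 : ∀ k, f (framePlane b k) = g (framePlane b k))
    (h2 : ∀ k, f (framePlanePerp b k) = g (framePlanePerp b k)) : f = g := by
  refine LinearMap.ext fun ξ => ?_
  rw [hb.expand ξ]
  simp only [map_sum, map_add, map_smul, h1, h2]

theorem IsOrthonormalFrame.frameStar_comm (hb : IsOrthonormalFrame h b) (ξ η : ⋀[ℝ]^2 V) :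
    ip2 h (frameStar h b ξ) η = ip2 h ξ (frameStar h b η) := by
  rw [ip2_symm hb.symm, hb.ip2_frameStar, hb.ip2_frameStar]
  exact Finset.sum_congr rfl fun k _ => by ring

/-- In the basis of the frame planes and their complements ⋆ exchanges the two halves, so commuting
with it means that the diagonal blocks agree and the off-diagonal blocks agree. -/
theorem IsOrthonormalFrame.commute_iff (hb : IsOrthonormalFrame h b)
    (A : ⋀[ℝ]^2 V →ₗ[ℝ] ⋀[ℝ]^2 V) :
    A ∘ₗ frameStar h b = frameStar h b ∘ₗ A ↔
      ∀ k l, ip2 h (A (framePlanePerp b k)) (framePlane b l) =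
          ip2 h (A (framePlane b k)) (framePlanePerp b l) ∧
        ip2 h (A (framePlanePerp b k)) (framePlanePerp b l) =
          ip2 h (A (framePlane b k)) (framePlane b l) := by
  constructor
  · intro hA k l
    have h1 := congrArg (fun f => f (framePlane b k)) hA
    simp only [LinearMap.comp_apply, hb.frameStar_framePlane] at h1
    rw [h1, hb.frameStar_comm, hb.frameStar_comm, hb.frameStar_framePlane,
      hb.frameStar_framePlanePerp]
    exact ⟨rfl, rfl⟩
  · intro hA
    have hext : ∀ {ξ η : ⋀[ℝ]^2 V}, (∀ k, ip2 h ξ (framePlane b k) = ip2 h η (framePlane b k)) →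
        (∀ k, ip2 h ξ (framePlanePerp b k) = ip2 h η (framePlanePerp b k)) → ξ = η := by
      intro ξ η h1 h2
      refine hb.ip2_ext fun v w => ?_
      rw [hb.hom_ext h1 h2]
    refine hb.hom_ext (fun k => ?_) (fun k => ?_)
    · refine hext (fun l => ?_) (fun l => ?_)
      · rw [LinearMap.comp_apply, LinearMap.comp_apply, hb.frameStar_comm,
          hb.frameStar_framePlane, hb.frameStar_framePlane, (hA k l).1]
      · rw [LinearMap.comp_apply, LinearMap.comp_apply, hb.frameStar_comm,
          hb.frameStar_framePlane, hb.frameStar_framePlanePerp, (hA k l).2]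
    · refine hext (fun l => ?_) (fun l => ?_)
      · rw [LinearMap.comp_apply, LinearMap.comp_apply, hb.frameStar_comm,
          hb.frameStar_framePlane, hb.frameStar_framePlanePerp, (hA k l).2]
      · rw [LinearMap.comp_apply, LinearMap.comp_apply, hb.frameStar_comm,
          hb.frameStar_framePlanePerp, hb.frameStar_framePlanePerp, (hA k l).1]

theorem IsOrthonormalFrame.ip2_curvatureOperator_framePlane (hb : IsOrthonormalFrame h b)
    (hR : IsAlgCurvatureTensor R) (k l : Fin 3) :
    ip2 h (curvatureOperator h R (framePlane b k)) (framePlane b l) =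
        -onPlane (onPlane R b k) b l ∧
      ip2 h (curvatureOperator h R (framePlane b k)) (framePlanePerp b l) =
        -onPlanePerp (onPlane R b k) b l ∧
      ip2 h (curvatureOperator h R (framePlanePerp b k)) (framePlane b l) =
        -onPlane (onPlanePerp R b k) b l ∧
      ip2 h (curvatureOperator h R (framePlanePerp b k)) (framePlanePerp b l) =
        -onPlanePerp (onPlanePerp R b k) b l := by
  have hA := hb.isCurvatureOperator hR
  refine ⟨?_, ?_, ?_, ?_⟩ <;> fin_cases k <;> fin_cases l <;>
    simp [framePlane, framePlanePerp, onPlane, onPlanePerp, hA _ _ _ _]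

/-- The trace of `⋆ R̂` vanishes, by the first Bianchi identity. -/
theorem IsOrthonormalFrame.sum_ip2_curvatureOperator (hb : IsOrthonormalFrame h b)
    (hR : IsAlgCurvatureTensor R) :
    ∑ k, ip2 h (curvatureOperator h R (framePlane b k)) (framePlanePerp b k) = 0 := by
  simp only [Fin.sum_univ_three, (hb.ip2_curvatureOperator_framePlane hR _ _).2.1, onPlane,
    onPlanePerp, Matrix.cons_val]
  have h1 := hR.bianchi (b 0) (b 1) (b 2) (b 3)
  rw [hR.pairSymm (b 1), hR.antisymm (b 2), hR.antisymm_right (b 0) (b 2)] at h1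
  linarith

/-- Let A and D be the diagonal blocks of R̂ and B an off-diagonal one. Mixed trace components (0,
i) measure the skew part of B. Spatial off-diagonal ones measure A - D off the diagonal. Equality of
the four diagonal components is a linear system forcing A and D to have the same diagonal. -/
theorem IsOrthonormalFrame.commutesWithStar_iff [FiniteDimensional ℝ V]
    {o : Orientation ℝ V (Fin 4)} (hb : IsOrthonormalFrame h b) (ho : b.orientation = o)
    (hR : IsAlgCurvatureTensor R) :
    CommutesWithStar h o R ↔ ∃ f : ℝ, ∀ v w, metricTrace h R v w = f * h v w := by
  have hp := hR.pairSymm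
  have hl := hR.antisymm
  have hr := hR.antisymm_right
  have hz : ∀ v x y, R v v x y = 0 := fun v x y => by linarith [hl v v x y]
  have hz' : ∀ v x y, R x y v v = 0 := fun v x y => by linarith [hr x y v v]
  rw [CommutesWithStar, hb.hodgeStar_eq ho, hb.commute_iff]
  simp only [hb.ip2_curvatureOperator_framePlane hR, neg_inj]
  have htr : (∃ f : ℝ, ∀ v w, metricTrace h R v w = f * h v w) ↔
      ∃ f : ℝ, ∀ i j, ∑ k, R (b k) (b i) (b j) (b k) = f * if i = j then 1 else 0 := by
    simp only [hb.metricTrace_eq hR]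
    refine exists_congr fun f => ⟨fun H i j => by rw [H, hb], fun H v w => ?_⟩
    have : hR.ricciForm b = f • h := by
      refine LinearMap.BilinForm.ext_basis b fun i j => ?_
      rw [hR.ricciForm_apply, H, LinearMap.smul_apply, LinearMap.smul_apply, hb, smul_eq_mul]
    rw [← hR.ricciForm_apply, this]
    simp
  rw [htr]
  -- These rewriting rules bring every component to one representative per symmetry class, so that
  -- `linarith` meets each unknown under a single name.
  have n1 : ∀ x y, R (b 1) (b 0) x y = -R (b 0) (b 1) x y := fun x y => hl _ _ _ _
  have n2 : ∀ x y, R (b 2) (b 0) x y = -R (b 0) (b 2) x y := fun x y => hl _ _ _ _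
  have n3 : ∀ x y, R (b 3) (b 0) x y = -R (b 0) (b 3) x y := fun x y => hl _ _ _ _
  have n4 : ∀ x y, R (b 3) (b 2) x y = -R (b 2) (b 3) x y := fun x y => hl _ _ _ _
  have n5 : ∀ x y, R (b 1) (b 3) x y = -R (b 3) (b 1) x y := fun x y => hl _ _ _ _
  have n6 : ∀ x y, R (b 2) (b 1) x y = -R (b 1) (b 2) x y := fun x y => hl _ _ _ _
  have m1 : ∀ x y, R x y (b 1) (b 0) = -R x y (b 0) (b 1) := fun x y => hr _ _ _ _
  have m2 : ∀ x y, R x y (b 2) (b 0) = -R x y (b 0) (b 2) := fun x y => hr _ _ _ _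
  have m3 : ∀ x y, R x y (b 3) (b 0) = -R x y (b 0) (b 3) := fun x y => hr _ _ _ _
  have m4 : ∀ x y, R x y (b 3) (b 2) = -R x y (b 2) (b 3) := fun x y => hr _ _ _ _
  have m5 : ∀ x y, R x y (b 1) (b 3) = -R x y (b 3) (b 1) := fun x y => hr _ _ _ _
  have m6 : ∀ x y, R x y (b 2) (b 1) = -R x y (b 1) (b 2) := fun x y => hr _ _ _ _
  have p1 : ∀ x, R (b 2) (b 3) (b 0) x = R (b 0) x (b 2) (b 3) := fun x => hp _ _ _ _
  have p2 : ∀ x, R (b 3) (b 1) (b 0) x = R (b 0) x (b 3) (b 1) := fun x => hp _ _ _ _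
  have p3 : ∀ x, R (b 1) (b 2) (b 0) x = R (b 0) x (b 1) (b 2) := fun x => hp _ _ _ _
  have p4 := hp (b 0) (b 2) (b 0) (b 1)
  have p5 := hp (b 0) (b 3) (b 0) (b 1)
  have p6 := hp (b 0) (b 3) (b 0) (b 2)
  have p7 := hp (b 3) (b 1) (b 2) (b 3)
  have p8 := hp (b 1) (b 2) (b 2) (b 3)
  have p9 := hp (b 1) (b 2) (b 3) (b 1)
  constructor
  · intro H
    have H1 := fun k l => (H k l).1
    have H2 := fun k l => (H k l).2
    simp only [Fin.forall_fin_succ, onPlane, onPlanePerp] at H1 H2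
    simp [p1, p2, p3, p4, p5, p6, p7, p8, p9] at H1 H2
    -- The factor is forced to be the trace on (e₀, e₀), as e₀ has length one.
    refine ⟨∑ k, R (b k) (b 0) (b 0) (b k), fun i j => ?_⟩
    fin_cases i <;> fin_cases j <;>
      simp [Fin.sum_univ_four, hz, hz', n1, n2, n3, n4, n5, n6, m1, m2, m3, m4, m5, m6, p1, p2, p3,
        p4, p5, p6, p7, p8, p9] <;> linarith
  · rintro ⟨f, H⟩
    simp only [Fin.forall_fin_succ] at H
    simp [Fin.sum_univ_four, hz, hz', n1, n2, n3, n4, n5, n6, m1, m2, m3, m4, m5, m6, p1, p2, p3,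
        p4, p5, p6, p7, p8, p9] at H
    intro k l
    fin_cases k <;> fin_cases l <;>
      simp [onPlane, onPlanePerp, p1, p2, p3, p4, p5, p6, p7, p8, p9] <;>
      first | linarith | (constructor <;> linarith)

end EinsteinCondition

/-! ### Self-dual and anti-self-dual 2-vectors, and quaternions -/

open scoped Quaternion RealInnerProductSpace

/-- The coordinate space of self-dual and of anti-self-dual 2-vectors. -/
abbrev E3 : Type := EuclideanSpace ℝ (Fin 3)

section SelfDual

variable {V : Type*} [AddCommGroup V] [Module ℝ V]

/-- The self-dual (`s = 1`) or anti-self-dual (`s = -1`) 2-vector `½ ∑ aₖ (Pₖ + s ⋆ Pₖ)`. -/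
def dualMap (s : ℝ) (e : Fin 4 → V) : E3 →ₗ[ℝ] ⋀[ℝ]^2 V :=
  (2⁻¹ : ℝ) • ∑ k, (EuclideanSpace.proj k : E3 →L[ℝ] ℝ).toLinearMap.smulRight
    (framePlane e k + s • framePlanePerp e k)

/-- The coordinates of the (anti-)self-dual part of a 2-vector. -/
def dualCoord (h : LinearMap.BilinForm ℝ V) (s : ℝ) (e : Fin 4 → V) : ⋀[ℝ]^2 V →ₗ[ℝ] E3 :=
  (WithLp.linearEquiv 2 ℝ (Fin 3 → ℝ)).symm.toLinearMap ∘ₗ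
    LinearMap.pi fun k => ip2 h (framePlane e k + s • framePlanePerp e k)

theorem dualMap_apply (s : ℝ) (e : Fin 4 → V) (a : E3) : dualMap s e a =
    (2⁻¹ : ℝ) • ∑ k, a k • (framePlane e k + s • framePlanePerp e k) := by
  simp [dualMap, -smul_add]

theorem dualCoord_apply (h : LinearMap.BilinForm ℝ V) (s : ℝ) (e : Fin 4 → V) (ξ : ⋀[ℝ]^2 V)
    (k : Fin 3) : dualCoord h s e ξ k =
      ip2 h (framePlane e k) ξ + s * ip2 h (framePlanePerp e k) ξ := by
  simp [dualCoord]

variable {h : LinearMap.BilinForm ℝ V} {b : Basis (Fin 4) ℝ V}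

theorem IsOrthonormalFrame.ip2_framePlane_dualMap (hb : IsOrthonormalFrame h b) (s : ℝ) (a : E3)
    (k : Fin 3) : ip2 h (framePlane b k) (dualMap s b a) = 2⁻¹ * a k := by
  simp [dualMap_apply, hb.ip2_framePlane, hb.ip2_framePlane_framePlanePerp]

theorem IsOrthonormalFrame.ip2_framePlanePerp_dualMap (hb : IsOrthonormalFrame h b) (s : ℝ)
    (a : E3) (k : Fin 3) : ip2 h (framePlanePerp b k) (dualMap s b a) = 2⁻¹ * (s * a k) := by
  simp [dualMap_apply, hb.ip2_framePlanePerp, hb.ip2_framePlanePerp_framePlane]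
  ring

theorem IsOrthonormalFrame.dualCoord_dualMap (hb : IsOrthonormalFrame h b) (s t : ℝ) (a : E3) :
    dualCoord h s b (dualMap t b a) = (2⁻¹ * (1 + s * t)) • a := by
  ext k
  rw [dualCoord_apply, hb.ip2_framePlane_dualMap, hb.ip2_framePlanePerp_dualMap, PiLp.smul_apply,
    smul_eq_mul]
  ring

theorem IsOrthonormalFrame.dualMap_dualCoord (hb : IsOrthonormalFrame h b) (ξ : ⋀[ℝ]^2 V) :
    dualMap 1 b (dualCoord h 1 b ξ) + dualMap (-1) b (dualCoord h (-1) b ξ) = ξ := by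
  conv_rhs => rw [hb.expand ξ]
  simp only [dualMap_apply, dualCoord_apply, Fin.sum_univ_three]
  module

theorem IsOrthonormalFrame.frameStar_dualMap (hb : IsOrthonormalFrame h b) {s : ℝ}
    (hs : s * s = 1) (a : E3) : frameStar h b (dualMap s b a) = s • dualMap s b a := by
  simp only [dualMap_apply, map_smul, map_sum, map_add, hb.frameStar_framePlane,
    hb.frameStar_framePlanePerp, smul_comm s (2⁻¹ : ℝ), Finset.smul_sum (r := s), smul_comm s (a _),
    smul_add s, smul_smul, hs, one_smul, add_comm]

theorem IsOrthonormalFrame.ip2_dualMap_right (hb : IsOrthonormalFrame h b) (s : ℝ)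
    (ξ : ⋀[ℝ]^2 V) (a : E3) : ip2 h ξ (dualMap s b a) = 2⁻¹ * ⟪dualCoord h s b ξ, a⟫ := by
  simp only [dualMap_apply, PiLp.inner_apply, dualCoord_apply, map_smul, map_sum, map_add,
    ip2_symm hb.symm ξ]
  simp [mul_add]

/-- The Plücker relation, seen as a determinant with a repeated vector. With the length condition it
supplies the constraints for critical planes. -/
theorem IsOrthonormalFrame.ip2_wedge_frameStar_wedge (hb : IsOrthonormalFrame h b) (v w : V) :
    ip2 h (wedge v w) (frameStar h b (wedge v w)) = 0 := by
  rw [← hb.det_eq]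
  exact b.det.map_eq_zero_of_eq _ (i := 0) (j := 2) rfl (by decide)

/-- The factor ½ in `dualMap` gives each half squared length ½, so unit planes correspond to pairs
of unit vectors. -/
theorem ip2_dualMap_add_self (hb : IsOrthonormalFrame h b) {a a' : E3} (ha : ‖a‖ = 1)
    (ha' : ‖a'‖ = 1) : ip2 h (dualMap 1 b a + dualMap (-1) b a')
      (dualMap 1 b a + dualMap (-1) b a') = 1 := by
  rw [map_add (ip2 h _), hb.ip2_dualMap_right, hb.ip2_dualMap_right, map_add, map_add,
    hb.dualCoord_dualMap, hb.dualCoord_dualMap, hb.dualCoord_dualMap, hb.dualCoord_dualMap]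
  norm_num [real_inner_self_eq_norm_sq, ha, ha']

/-! ### Quaternions -/

/-- The imaginary quaternion with given coordinates. -/
def imQuat (a : E3) : ℍ[ℝ] := ⟨0, a 0, a 1, a 2⟩

@[simp] theorem imQuat_re (a : E3) : (imQuat a).re = 0 := rfl
@[simp] theorem imQuat_imI (a : E3) : (imQuat a).imI = a 0 := rfl
@[simp] theorem imQuat_imJ (a : E3) : (imQuat a).imJ = a 1 := rfl
@[simp] theorem imQuat_imK (a : E3) : (imQuat a).imK = a 2 := rfl

/-- The vector whose coordinates in the basis `b` are those of a quaternion. -/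
def quatVec (b : Basis (Fin 4) ℝ V) (x : ℍ[ℝ]) : V :=
  b.equivFun.symm ![x.re, x.imI, x.imJ, x.imK]

theorem quatVec_repr (b : Basis (Fin 4) ℝ V) (x : ℍ[ℝ]) (i : Fin 4) :
    b.repr (quatVec b x) i = ![x.re, x.imI, x.imJ, x.imK] i := by
  rw [← b.equivFun_apply, quatVec, LinearEquiv.apply_symm_apply]

theorem IsOrthonormalFrame.apply_quatVec (hb : IsOrthonormalFrame h b) (x y : ℍ[ℝ]) :
    h (quatVec b x) (quatVec b y) = (y * star x).re := by
  rw [hb.apply_eq_sum]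
  simp [Fin.sum_univ_four, quatVec_repr]
  ring

/-- Left and right multiplication by imaginary quaternions are the two factors of so(4) = so(3) ⊕
so(3), that is Λ⁺ and Λ⁻; here this is checked in coordinates. -/
theorem IsOrthonormalFrame.wedge_quatVec (hb : IsOrthonormalFrame h b) {x y : ℍ[ℝ]} {a a' : E3}
    (h1 : y * star x = imQuat a) (h2 : star x * y = imQuat a') :
    wedge (quatVec b x) (quatVec b y) = dualMap 1 b a + dualMap (-1) b a' := by
  have ha : dualCoord h 1 b (wedge (quatVec b x) (quatVec b y)) = a := by
    have e1 := congrArg QuaternionAlgebra.imI h1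
    have e2 := congrArg QuaternionAlgebra.imJ h1
    have e3 := congrArg QuaternionAlgebra.imK h1
    simp at e1 e2 e3
    ext k
    rw [dualCoord_apply]
    fin_cases k <;> simp [framePlane, framePlanePerp, ip2_wedge, hb.repr_eq, quatVec_repr] <;>
      linarith
  have ha' : dualCoord h (-1) b (wedge (quatVec b x) (quatVec b y)) = a' := by
    have e1 := congrArg QuaternionAlgebra.imI h2
    have e2 := congrArg QuaternionAlgebra.imJ h2
    have e3 := congrArg QuaternionAlgebra.imK h2
    simp at e1 e2 e3
    ext k
    rw [dualCoord_apply]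
    fin_cases k <;> simp [framePlane, framePlanePerp, ip2_wedge, hb.repr_eq, quatVec_repr] <;>
      linarith
  rw [← hb.dualMap_dualCoord (wedge (quatVec b x) (quatVec b y)), ha, ha']

theorem imQuat_mul_self {a : E3} (ha : ‖a‖ = 1) : imQuat a * imQuat a = -1 := by
  have h1 : a 0 ^ 2 + a 1 ^ 2 + a 2 ^ 2 = 1 := by
    have := EuclideanSpace.norm_sq_eq a
    simpa [ha, Fin.sum_univ_three] using this.symm
  ext <;> simp <;> linarith

theorem imQuat_anticomm {a a' : E3} (ha : ⟪a, a'⟫ = 0) :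
    imQuat a' * imQuat a = -(imQuat a * imQuat a') := by
  have h1 : a 0 * a' 0 + a 1 * a' 1 + a 2 * a' 2 = 0 := by
    simpa [PiLp.inner_apply, Fin.sum_univ_three, mul_comm] using ha
  ext <;> simp <;> linarith

theorem star_imQuat (a : E3) : star (imQuat a) = -imQuat a := by
  ext <;> simp

/-- The sum is the trace of y ↦ p y q in the basis 1, i, j, k. It shows below that certain averages
do not vanish identically. -/
theorem sum_conj_components (p q : ℍ[ℝ]) (hp : p.re = 0) :
    (p * 1 * q).re + (p * imQuat (EuclideanSpace.single 0 1) * q).imI +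
      (p * imQuat (EuclideanSpace.single 1 1) * q).imJ +
      (p * imQuat (EuclideanSpace.single 2 1) * q).imK = 0 := by
  simp [hp]
  ring

theorem exists_unit_of_ne_zero {x : ℍ[ℝ]} (hx : x ≠ 0) :
    ∃ c : ℝ, (c • x) * star (c • x) = 1 ∧ star (c • x) * (c • x) = 1 := by
  have hn : ‖x‖ ≠ 0 := norm_ne_zero_iff.2 hx
  have h1 : Quaternion.normSq (‖x‖⁻¹ • x) = 1 := by
    rw [Quaternion.normSq_eq_norm_mul_self, norm_smul, norm_inv, norm_norm, inv_mul_cancel₀ hn,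
      one_mul]
  refine ⟨‖x‖⁻¹, ?_, ?_⟩
  · rw [Quaternion.self_mul_star, h1]; rfl
  · rw [Quaternion.star_mul_self, h1]; rfl

/-- The map y ↦ y - A y A' is, up to a factor, averaging over the group generated by A, so its
values intertwine A and A'. If it vanished, y ↦ A y A' would be the identity, of trace 4, but its
trace is 0. -/
theorem exists_conj_of_sq {A A' : ℍ[ℝ]} (hA : A * A = -1) (hA' : A' * A' = -1) (hre : A.re = 0) :
    ∃ x : ℍ[ℝ], x * star x = 1 ∧ star x * x = 1 ∧ A * x = x * A' := by
  have hcomm : ∀ y, A * (y - A * y * A') = (y - A * y * A') * A' := by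
    intro y
    have h1 : A * (A * y * A') = -(y * A') := by
      rw [← mul_assoc, ← mul_assoc, hA, neg_one_mul, neg_mul]
    have h2 : A * y * A' * A' = -(A * y) := by rw [mul_assoc, hA', mul_neg_one]
    rw [mul_sub, sub_mul, h1, h2]
    abel
  have hex : ∃ y, y - A * y * A' ≠ 0 := by
    by_contra! hall
    have h0 := sum_conj_components A A' hre
    simp only [← sub_eq_zero.1 (hall _)] at h0
    norm_num at h0
  obtain ⟨y, hy⟩ := hex
  obtain ⟨c, h1, h2⟩ := exists_unit_of_ne_zero hy
  exact ⟨_, h1, h2, by rw [mul_smul_comm, hcomm, smul_mul_assoc]⟩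

/-- Unit quaternions act on imaginary ones through all of SO(3). The intertwiner is an average over
the quaternion group generated by A and B; the summand y contributes trace 4 and the other three
contribute 0, so the average is not identically zero. -/
theorem exists_conj_of_anticomm {A B A' B' : ℍ[ℝ]} (hA : A * A = -1) (hB : B * B = -1)
    (hBA : B * A = -(A * B)) (hA' : A' * A' = -1) (hB' : B' * B' = -1)
    (hBA' : B' * A' = -(A' * B')) (hreA : A.re = 0) (hreB : B.re = 0) (hreAB : (A * B).re = 0) :
    ∃ x : ℍ[ℝ], x * star x = 1 ∧ star x * x = 1 ∧ A * x = x * A' ∧ B * x = x * B' := by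
  let f : ℍ[ℝ] → ℍ[ℝ] := fun y => y - A * y * A' - B * y * B' - (A * B) * y * (A' * B')
  have hAA : ∀ z, A * (A * z) = -z := fun z => by rw [← mul_assoc, hA, neg_one_mul]
  have hBB : ∀ z, B * (B * z) = -z := fun z => by rw [← mul_assoc, hB, neg_one_mul]
  have hBAz : ∀ z, B * (A * z) = -(A * (B * z)) := fun z => by
    rw [← mul_assoc, hBA, neg_mul, mul_assoc]
  have hAA' : ∀ z, A' * (A' * z) = -z := fun z => by rw [← mul_assoc, hA', neg_one_mul]
  have hBAz' : ∀ z, B' * (A' * z) = -(A' * (B' * z)) := fun z => by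
    rw [← mul_assoc, hBA', neg_mul, mul_assoc]
  have hcA : ∀ y, A * f y = f y * A' := by
    intro y
    simp only [f, mul_sub, sub_mul, mul_assoc, hAA, hA', hBA', mul_neg, mul_one, hAA']
    abel
  have hcB : ∀ y, B * f y = f y * B' := by
    intro y
    simp only [f, mul_sub, sub_mul, mul_assoc, hBB, hB', hBAz, mul_neg, mul_one]
    abel
  have hex : ∃ y, f y ≠ 0 := by
    by_contra! hall
    have h1 := sum_conj_components A A' hreA
    have h2 := sum_conj_components B B' hreB
    have h3 := sum_conj_components (A * B) (A' * B') hreAB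
    have k1 := congrArg QuaternionAlgebra.re (hall 1)
    have k2 := congrArg QuaternionAlgebra.imI (hall (imQuat (EuclideanSpace.single 0 1)))
    have k3 := congrArg QuaternionAlgebra.imJ (hall (imQuat (EuclideanSpace.single 1 1)))
    have k4 := congrArg QuaternionAlgebra.imK (hall (imQuat (EuclideanSpace.single 2 1)))
    simp only [f, Quaternion.re_sub, Quaternion.imI_sub, Quaternion.imJ_sub, Quaternion.imK_sub,
      Quaternion.re_zero, Quaternion.imI_zero, Quaternion.imJ_zero, Quaternion.imK_zero,
      Quaternion.re_one, imQuat_imI, imQuat_imJ, imQuat_imK] at k1 k2 k3 k4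
    norm_num at k1 k2 k3 k4
    norm_num at h1 h2 h3
    linarith
  obtain ⟨y, hy⟩ := hex
  obtain ⟨c, h1, h2⟩ := exists_unit_of_ne_zero hy
  exact ⟨_, h1, h2, by rw [mul_smul_comm, hcA, smul_mul_assoc],
    by rw [mul_smul_comm, hcB, smul_mul_assoc]⟩

/-- With x a unit quaternion conjugating a into a', the plane is x ∧ (a x): its halves are a x x̄ =
a and x̄ a x = a'. -/
theorem IsOrthonormalFrame.dualMap_add_mem_unitPlanes (hb : IsOrthonormalFrame h b) {a a' : E3}
    (ha : ‖a‖ = 1) (ha' : ‖a'‖ = 1) : dualMap 1 b a + dualMap (-1) b a' ∈ unitPlanes h := by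
  refine ⟨ip2_dualMap_add_self hb ha ha', ?_⟩
  obtain ⟨x, h1, h2, h3⟩ := exists_conj_of_sq (imQuat_mul_self ha) (imQuat_mul_self ha') rfl
  refine ⟨quatVec b x, quatVec b (imQuat a * x), (hb.wedge_quatVec ?_ ?_).symm⟩
  · rw [mul_assoc, h1, mul_one]
  · rw [h3, ← mul_assoc, h2, one_mul]

end SelfDual

/-! ### Critical planes and eigenvectors -/

section CriticalPlanes

variable {V : Type*} [AddCommGroup V] [Module ℝ V] {h : LinearMap.BilinForm ℝ V}
  {b : Basis (Fin 4) ℝ V} {R : V → V → V → V → ℝ}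

/-- Smoothness of a curve is phrased through linear functionals, so its velocity is assembled from
the derivatives of six coordinates. -/
theorem IsOrthonormalFrame.exists_deriv (hb : IsOrthonormalFrame h b) {c : ℝ → ⋀[ℝ]^2 V}
    (hc : IsSmoothCurve c) : ∃ c' : ⋀[ℝ]^2 V, ∀ φ : ⋀[ℝ]^2 V →ₗ[ℝ] ℝ,
      HasDerivAt (fun t => φ (c t)) (φ c') 0 := by
  have hd : ∀ φ : ⋀[ℝ]^2 V →ₗ[ℝ] ℝ, HasDerivAt (fun t => φ (c t)) (deriv (fun t => φ (c t)) 0) 0 :=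
    fun φ => ((hc φ).differentiable (by simp) 0).hasDerivAt
  refine ⟨∑ k, (deriv (fun t => ip2 h (framePlane b k) (c t)) 0 • framePlane b k +
    deriv (fun t => ip2 h (framePlanePerp b k) (c t)) 0 • framePlanePerp b k), fun φ => ?_⟩
  have hφ : (fun t => φ (c t)) = fun t => ∑ k, (ip2 h (framePlane b k) (c t) * φ (framePlane b k) +
      ip2 h (framePlanePerp b k) (c t) * φ (framePlanePerp b k)) := by
    funext t
    conv_lhs => rw [hb.expand (c t)]
    simp
  rw [hφ]
  simp only [map_sum, map_add, map_smul, smul_eq_mul]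
  exact HasDerivAt.fun_sum fun k _ => ((hd _).mul_const _).add ((hd _).mul_const _)

theorem IsOrthonormalFrame.hasDerivAt_bilin (hb : IsOrthonormalFrame h b) {c : ℝ → ⋀[ℝ]^2 V}
    {c' : ⋀[ℝ]^2 V} (hc : ∀ φ : ⋀[ℝ]^2 V →ₗ[ℝ] ℝ, HasDerivAt (fun t => φ (c t)) (φ c') 0)
    (B : LinearMap.BilinForm ℝ (⋀[ℝ]^2 V)) :
    HasDerivAt (fun t => B (c t) (c t)) (B c' (c 0) + B (c 0) c') 0 := by
  have hB : ∀ ξ η, B ξ η = ∑ k, (ip2 h (framePlane b k) ξ * B (framePlane b k) η +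
      ip2 h (framePlanePerp b k) ξ * B (framePlanePerp b k) η) := by
    intro ξ η
    conv_lhs => rw [hb.expand ξ]
    simp only [map_sum, map_add, map_smul, LinearMap.sum_apply, LinearMap.add_apply,
      LinearMap.smul_apply, smul_eq_mul]
  have hsum : B c' (c 0) + B (c 0) c' = ∑ k,
      ((ip2 h (framePlane b k) c' * B (framePlane b k) (c 0) +
        ip2 h (framePlane b k) (c 0) * B (framePlane b k) c') +
      (ip2 h (framePlanePerp b k) c' * B (framePlanePerp b k) (c 0) +
        ip2 h (framePlanePerp b k) (c 0) * B (framePlanePerp b k) c')) := by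
    rw [hB c', hB (c 0), ← Finset.sum_add_distrib]
    exact Finset.sum_congr rfl fun k _ => by ring
  rw [hsum]
  simp only [fun t => hB (c t) (c t)]
  exact HasDerivAt.fun_sum fun k _ => ((hc _).mul (hc _)).add ((hc _).mul (hc _))

/-- Lagrange multipliers: the planes satisfy ⟨P, P⟩ = 1 and ⟨P, ⋆P⟩ = 0, whose gradients are
proportional to P and ⋆P, and the hypothesis puts the gradient of q in their span. -/
theorem IsOrthonormalFrame.isCriticalPlane_of_apply_eq (hb : IsOrthonormalFrame h b)
    (hR : IsAlgCurvatureTensor R) {P : ⋀[ℝ]^2 V} (hP : P ∈ unitPlanes h) {l m : ℝ}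
    (hA : curvatureOperator h R P = l • P + m • frameStar h b P) : IsCriticalPlane h R P := by
  refine ⟨hP, fun c hc hcu hc0 => ?_⟩
  obtain ⟨c', hc'⟩ := hb.exists_deriv hc
  have h1 := hb.hasDerivAt_bilin hc' (ip2 h)
  -- The two flips produce the form (ξ, η) ↦ ⟨ξ, ⋆η⟩.
  have h2 := hb.hasDerivAt_bilin hc' (LinearMap.flip (LinearMap.flip (ip2 h) ∘ₗ frameStar h b))
  have h3 := hb.hasDerivAt_bilin hc' (ip2 h ∘ₗ curvatureOperator h R)
  simp only [LinearMap.comp_apply, LinearMap.flip_apply, hc0] at h1 h2 h3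
  have e1 : (fun t => ip2 h (c t) (c t)) = fun _ => 1 := funext fun t => (hcu t).1
  have e2 : (fun t => ip2 h (c t) (frameStar h b (c t))) = fun _ => 0 := by
    funext t
    obtain ⟨v, w, hvw⟩ := (hcu t).2
    rw [hvw, hb.ip2_wedge_frameStar_wedge]
  rw [e1] at h1
  rw [e2] at h2
  have z1 := h1.unique (hasDerivAt_const 0 1)
  have z2 := h2.unique (hasDerivAt_const 0 0)
  rw [ip2_symm hb.symm P c'] at z1
  rw [← hb.frameStar_comm P, ip2_symm hb.symm _ c'] at z2
  have h4 : ip2 h (curvatureOperator h R c') P + ip2 h (curvatureOperator h R P) c' = 0 := by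
    rw [hb.ip2_curvatureOperator_comm hR c', ip2_symm hb.symm _ c', hA, map_add, map_smul, map_smul,
      smul_eq_mul, smul_eq_mul]
    linear_combination l * z1 + m * z2
  rw [h4] at h3
  exact h3

/-- The derivative of q is taken along the great circle through a with velocity d in one factor of
S² × S², the other factor being held fixed. The sign s serves both factors. -/
theorem IsOrthonormalFrame.inner_dualCoord_of_isCriticalPlane (hb : IsOrthonormalFrame h b)
    (hR : IsAlgCurvatureTensor R) {s : ℝ} (hs : s = 1 ∨ s = -1) {a a' d : E3} (ha : ‖a‖ = 1)
    (ha' : ‖a'‖ = 1) (hd : ‖d‖ = 1) (had : ⟪a, d⟫ = 0)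
    (hP : IsCriticalPlane h R (dualMap s b a + dualMap (-s) b a')) :
    ⟪dualCoord h s b (curvatureOperator h R (dualMap s b a + dualMap (-s) b a')), d⟫ = 0 := by
  set P := dualMap s b a + dualMap (-s) b a' with hPdef
  let c : ℝ → ⋀[ℝ]^2 V := fun t =>
    dualMap s b (Real.cos t • a + Real.sin t • d) + dualMap (-s) b a'
  have hφ : ∀ φ : ⋀[ℝ]^2 V →ₗ[ℝ] ℝ, (fun t => φ (c t)) = fun t =>
      Real.cos t * φ (dualMap s b a) + Real.sin t * φ (dualMap s b d) + φ (dualMap (-s) b a') := by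
    intro φ
    funext t
    simp [c]
  have hsm : IsSmoothCurve c := by
    intro φ
    rw [hφ]
    exact ((Real.contDiff_cos.mul contDiff_const).add
      (Real.contDiff_sin.mul contDiff_const)).add contDiff_const
  have hun : ∀ t, c t ∈ unitPlanes h := by
    intro t
    have hn : ‖Real.cos t • a + Real.sin t • d‖ = 1 := by
      have h1 : ‖Real.cos t • a + Real.sin t • d‖ ^ 2 = 1 := by
        rw [norm_add_sq_real, norm_smul, norm_smul, ha, hd, inner_smul_left, inner_smul_right, had]
        simp
      nlinarith [norm_nonneg (Real.cos t • a + Real.sin t • d)]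
    rcases hs with rfl | rfl
    · exact hb.dualMap_add_mem_unitPlanes hn ha'
    · simp only [c, neg_neg]
      rw [add_comm]
      exact hb.dualMap_add_mem_unitPlanes ha' hn
  have hc0 : c 0 = P := by simp [c, hPdef]
  have hder : ∀ φ : ⋀[ℝ]^2 V →ₗ[ℝ] ℝ, HasDerivAt (fun t => φ (c t)) (φ (dualMap s b d)) 0 := by
    intro φ
    rw [hφ]
    have := (((Real.hasDerivAt_cos 0).mul_const (φ (dualMap s b a))).add
      ((Real.hasDerivAt_sin 0).mul_const (φ (dualMap s b d)))).add_const (φ (dualMap (-s) b a'))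
    simpa using this
  have h1 := hb.hasDerivAt_bilin hder (ip2 h ∘ₗ curvatureOperator h R)
  have h2 := (hP.2 c hsm hun hc0).unique h1
  simp only [LinearMap.comp_apply, hc0] at h2
  rw [hb.ip2_curvatureOperator_comm hR (dualMap s b d), ip2_symm hb.symm (dualMap s b d),
    hb.ip2_dualMap_right] at h2
  linarith

theorem eq_smul_of_inner_eq_zero {a r : E3} (ha : ‖a‖ = 1)
    (h : ∀ d : E3, ‖d‖ = 1 → ⟪a, d⟫ = 0 → ⟪r, d⟫ = 0) : r = ⟪r, a⟫ • a := by
  set q := r - ⟪r, a⟫ • a with hq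
  have haq : ⟪a, q⟫ = 0 := by
    rw [hq, inner_sub_right, inner_smul_right, real_inner_self_eq_norm_sq, ha, real_inner_comm]
    ring
  by_contra hne
  have hq0 : q ≠ 0 := fun h0 => hne (sub_eq_zero.1 h0)
  have h1 := h (‖q‖⁻¹ • q) (by
    rw [norm_smul, norm_inv, norm_norm, inv_mul_cancel₀ (norm_ne_zero_iff.2 hq0)])
    (by rw [inner_smul_right, haq, mul_zero])
  rw [inner_smul_right, mul_eq_zero, or_iff_right (inv_ne_zero (norm_ne_zero_iff.2 hq0))] at h1
  have h2 : ⟪q, q⟫ = 0 := by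
    nth_rewrite 1 [hq]
    rw [inner_sub_left, h1, inner_smul_left, haq]
    simp
  exact hq0 (inner_self_eq_zero.1 h2)

/-- The curvature operator at a critical plane. -/
theorem IsOrthonormalFrame.apply_of_isCriticalPlane (hb : IsOrthonormalFrame h b)
    (hR : IsAlgCurvatureTensor R) {a a' : E3} (ha : ‖a‖ = 1) (ha' : ‖a'‖ = 1)
    (hP : IsCriticalPlane h R (dualMap 1 b a + dualMap (-1) b a')) :
    ∃ l m : ℝ, curvatureOperator h R (dualMap 1 b a + dualMap (-1) b a') =
      l • dualMap 1 b a + m • dualMap (-1) b a' := by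
  have h1 := eq_smul_of_inner_eq_zero ha fun d hd had =>
    hb.inner_dualCoord_of_isCriticalPlane hR (Or.inl rfl) ha ha' hd had hP
  have hP' : IsCriticalPlane h R (dualMap (-1) b a' + dualMap (- -1) b a) := by
    rwa [neg_neg, add_comm]
  have h2 := eq_smul_of_inner_eq_zero ha' fun d hd had =>
    hb.inner_dualCoord_of_isCriticalPlane hR (Or.inr rfl) ha' ha hd had hP'
  rw [neg_neg, add_comm] at h2
  rw [← hb.dualMap_dualCoord (curvatureOperator h R (dualMap 1 b a + dualMap (-1) b a')), h1, h2,
    map_smul, map_smul]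
  exact ⟨_, _, rfl⟩

/-! ### Operators commuting with the Hodge star -/

theorem IsOrthonormalFrame.eq_dualMap_of_frameStar_eq (hb : IsOrthonormalFrame h b) {s : ℝ}
    (hs : s = 1 ∨ s = -1) {ξ : ⋀[ℝ]^2 V} (h1 : frameStar h b ξ = s • ξ) :
    ξ = dualMap s b (dualCoord h s b ξ) := by
  have h2 := hb.dualMap_dualCoord ξ
  have h3 : frameStar h b ξ = dualMap 1 b (dualCoord h 1 b ξ) -
      dualMap (-1) b (dualCoord h (-1) b ξ) := by
    conv_lhs => rw [← h2]
    rw [map_add, hb.frameStar_dualMap (by norm_num), hb.frameStar_dualMap (by norm_num)]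
    module
  rw [h1] at h3
  apply smul_right_injective _ (two_ne_zero (α := ℝ))
  rcases hs with rfl | rfl
  · linear_combination (norm := module) h3 - h2
  · linear_combination (norm := module) -h3 - h2

theorem IsOrthonormalFrame.apply_dualMap_of_commute (hb : IsOrthonormalFrame h b)
    {A : ⋀[ℝ]^2 V →ₗ[ℝ] ⋀[ℝ]^2 V} (hA : A ∘ₗ frameStar h b = frameStar h b ∘ₗ A) {s : ℝ}
    (hs : s = 1 ∨ s = -1) (a : E3) :
    A (dualMap s b a) = dualMap s b (dualCoord h s b (A (dualMap s b a))) := by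
  refine hb.eq_dualMap_of_frameStar_eq hs ?_
  have := congrArg (fun f => f (dualMap s b a)) hA
  simp only [LinearMap.comp_apply] at this
  rw [← this, hb.frameStar_dualMap (by rcases hs with rfl | rfl <;> norm_num), map_smul]

end CriticalPlanes

/-! ### Existence and uniqueness of the normal form -/

section NormalForm

variable {V : Type*} [AddCommGroup V] [Module ℝ V] {h : LinearMap.BilinForm ℝ V}
  {b : Basis (Fin 4) ℝ V} {R : V → V → V → V → ℝ} {o : Orientation ℝ V (Fin 4)}

theorem IsOrthonormalFrame.linearIndependent {e : Fin 4 → V} (he : IsOrthonormalFrame h e) :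
    LinearIndependent ℝ e := by
  rw [Fintype.linearIndependent_iff]
  intro a ha i
  have h1 := congrArg (fun v => h v (e i)) ha
  simpa [LinearMap.sum_apply, he _ i] using h1

/-! ### Adapted eigenbases -/

theorem exists_cross {a a' : E3} (h0 : ⟪a, a'⟫ = 0) :
    ∃ c : E3, imQuat c = imQuat a * imQuat a' ∧ ⟪a, c⟫ = 0 ∧ ⟪a', c⟫ = 0 := by
  have h1 : a 0 * a' 0 + a 1 * a' 1 + a 2 * a' 2 = 0 := by
    simpa [PiLp.inner_apply, Fin.sum_univ_three, mul_comm] using h0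
  refine ⟨!₂[a 1 * a' 2 - a 2 * a' 1, a 2 * a' 0 - a 0 * a' 2, a 0 * a' 1 - a 1 * a' 0], ?_, ?_, ?_⟩
  · ext <;> simp <;> linarith
  · simp [PiLp.inner_apply, Fin.sum_univ_three]
    ring
  · simp [PiLp.inner_apply, Fin.sum_univ_three]
    ring

theorem exists_sorted_eigenbasis {L : E3 →ₗ[ℝ] E3} (hL : L.IsSymmetric) :
    ∃ (d : Fin 3 → ℝ) (a : Fin 3 → E3), Antitone d ∧ ‖a 0‖ = 1 ∧ ‖a 1‖ = 1 ∧ ⟪a 0, a 1⟫ = 0 ∧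
      imQuat (a 2) = imQuat (a 0) * imQuat (a 1) ∧ ∀ i, L (a i) = d i • a i := by
  have hn : finrank ℝ E3 = 3 := finrank_euclideanSpace_fin
  set u := hL.eigenvectorBasis hn
  have h01 : ⟪u 0, u 1⟫ = 0 := u.inner_eq_zero (by decide)
  -- An orthonormal eigenbasis may have the wrong orientation. The cross product of its first two
  -- vectors is a multiple of the third, hence still an eigenvector, and makes the basis positive.
  obtain ⟨c, hc, hc0, hc1⟩ := exists_cross h01
  have hcu : c = ⟪u 2, c⟫ • u 2 := by
    conv_lhs => rw [← u.sum_repr' c]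
    rw [Fin.sum_univ_three, hc0, hc1, zero_smul, zero_smul, zero_add, zero_add]
  have hu : ∀ i, L (u i) = hL.eigenvalues hn i • u i := hL.apply_eigenvectorBasis hn
  refine ⟨hL.eigenvalues hn, ![u 0, u 1, c], hL.eigenvalues_antitone hn, u.norm_eq_one 0,
    u.norm_eq_one 1, h01, hc, fun i => ?_⟩
  fin_cases i
  · exact hu 0
  · exact hu 1
  · change L c = hL.eigenvalues hn 2 • c
    rw [hcu, map_smul, hu, smul_comm]

theorem imQuat_neg (a : E3) : imQuat (-a) = -imQuat a := by
  ext <;> simp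

/-- Surjectivity of SO(4) → SO(3) × SO(3). If the unit quaternion x satisfies A x = x A' and B x = x
B', the frame x, Ax, Bx, ABx has the required planes. -/
theorem IsOrthonormalFrame.exists_frame (hb : IsOrthonormalFrame h b) {a a' : Fin 3 → E3}
    (h0 : ‖a 0‖ = 1) (h1 : ‖a 1‖ = 1) (h01 : ⟪a 0, a 1⟫ = 0)
    (h2 : imQuat (a 2) = imQuat (a 0) * imQuat (a 1)) (h0' : ‖a' 0‖ = 1) (h1' : ‖a' 1‖ = 1)
    (h01' : ⟪a' 0, a' 1⟫ = 0) (h2' : imQuat (a' 2) = imQuat (a' 0) * imQuat (a' 1)) :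
    ∃ c : Basis (Fin 4) ℝ V, IsOrthonormalFrame h c ∧ c.orientation = b.orientation ∧
      (∀ k, framePlane c k = dualMap 1 b (a k) + dualMap (-1) b (a' k)) ∧
      ∀ k, framePlanePerp c k = dualMap 1 b (a k) - dualMap (-1) b (a' k) := by
  have hA := imQuat_mul_self h0
  have hB := imQuat_mul_self h1
  have hBA := imQuat_anticomm h01
  have hA' := imQuat_mul_self h0'
  have hB' := imQuat_mul_self h1'
  have hBA' := imQuat_anticomm h01'
  have sA := star_imQuat (a 0)
  have sB := star_imQuat (a 1)
  have sA' := star_imQuat (a' 0)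
  have sB' := star_imQuat (a' 1)
  have rA : (imQuat (a 0)).re = 0 := rfl
  have rB : (imQuat (a 1)).re = 0 := rfl
  have rAB : (imQuat (a 0) * imQuat (a 1)).re = 0 := by rw [← h2]; rfl
  obtain ⟨x, hx, hx', hxA, hxB⟩ := exists_conj_of_anticomm hA hB hBA hA' hB' hBA' rA rB rAB
  have e0 := fun k => imQuat_neg (a' k)
  -- Only the quaternion relations between these elements matter from here on, not their
  -- coordinates.
  generalize hAq : imQuat (a 0) = A at *
  generalize hBq : imQuat (a 1) = B at *
  generalize hAq' : imQuat (a' 0) = A' at *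
  generalize hBq' : imQuat (a' 1) = B' at *
  have hAA : ∀ z, A * (A * z) = -z := fun z => by rw [← mul_assoc, hA, neg_one_mul]
  have hBAz : ∀ z, B * (A * z) = -(A * (B * z)) := fun z => by
    rw [← mul_assoc, hBA, neg_mul, mul_assoc]
  have hAA' : ∀ z, A' * (A' * z) = -z := fun z => by rw [← mul_assoc, hA', neg_one_mul]
  have hBAz' : ∀ z, B' * (A' * z) = -(A' * (B' * z)) := fun z => by
    rw [← mul_assoc, hBA', neg_mul, mul_assoc]
  let q : Fin 4 → ℍ[ℝ] := ![1, A, B, A * B]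
  let q' : Fin 4 → ℍ[ℝ] := ![1, A', B', A' * B']
  -- Writing each frame vector both ways lets x cancel from y x̄ and from x̄ y.
  have hq : ∀ i, q i * x = x * q' i := by
    intro i
    fin_cases i
    · simp [q, q']
    · exact hxA
    · exact hxB
    · change A * B * x = x * (A' * B')
      rw [mul_assoc, hxB, ← mul_assoc, hxA, mul_assoc]
  let e : Fin 4 → V := fun i => quatVec b (q i * x)
  have he : IsOrthonormalFrame h e := by
    intro i j
    rw [hb.apply_quatVec, star_mul, mul_assoc, ← mul_assoc x, hx, one_mul]
    fin_cases i <;> fin_cases j <;>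
      simp [-QuaternionAlgebra.re_mul, -Quaternion.re_mul, q, sA, sB, mul_assoc, hA, hB, hBA, hAA,
        hBAz, rA, rB, rAB]
  have hw : ∀ i j (v w : E3), q j * star (q i) = imQuat v → star (q' i) * q' j = imQuat w →
      wedge (e i) (e j) = dualMap 1 b v + dualMap (-1) b w := by
    intro i j v w hv hw
    refine hb.wedge_quatVec ?_ ?_
    · rw [star_mul, mul_assoc, ← mul_assoc x, hx, one_mul, hv]
    · rw [hq, hq, star_mul, mul_assoc, ← mul_assoc (star x), hx', one_mul, hw]
  have hP : ∀ k, framePlane e k = dualMap 1 b (a k) + dualMap (-1) b (a' k) := by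
    intro k
    fin_cases k
    · exact hw 0 1 _ _ (by simp [q, hAq]) (by simp [q', hAq'])
    · exact hw 0 2 _ _ (by simp [q, hBq]) (by simp [q', hBq'])
    · exact hw 0 3 _ _ (by simp [q, h2]) (by simp [q', h2'])
  have hQ : ∀ k, framePlanePerp e k = dualMap 1 b (a k) - dualMap (-1) b (a' k) := by
    intro k
    rw [sub_eq_add_neg, ← map_neg]
    fin_cases k
    · exact hw 2 3 _ _ (by simp [q, sB, mul_assoc, hB, hAq])
        (by simp [q', sB', e0, hBAz', hB', hAq'])
    · exact hw 3 1 _ _ (by simp [q, sA, sB, hBA, hAA, hBq])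
        (by simp [q', sA', sB', e0, hBA', hAA', mul_assoc, hBq'])
    · exact hw 1 2 _ _ (by simp [q, sA, hBA, h2]) (by simp [q', sA', e0, h2'])
  let c := basisOfLinearIndependentOfCardEqFinrank he.linearIndependent
    (by rw [finrank_eq_card_basis b])
  have hce : (⇑c : Fin 4 → V) = e := coe_basisOfLinearIndependentOfCardEqFinrank _ _
  refine ⟨c, by rwa [hce], ?_, by rwa [hce], by rwa [hce]⟩
  -- The determinant is ⟨P, ⋆Q⟩ for the first plane P and its complement Q, and the formulas for the
  -- halves give ⋆Q = P.
  have hdet : b.det c = 1 := by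
    have hce' : (⇑c : Fin 4 → V) = ![e 0, e 1, e 2, e 3] := by
      rw [hce]
      ext i
      fin_cases i <;> rfl
    have e1 : wedge (e 0) (e 1) = _ := hP 0
    have e2 : wedge (e 2) (e 3) = _ := hQ 0
    rw [hce', hb.det_eq, e1, e2, map_sub, hb.frameStar_dualMap (by norm_num),
      hb.frameStar_dualMap (by norm_num), one_smul, neg_one_smul, sub_neg_eq_add]
    exact ip2_dualMap_add_self hb h0 h0'
  refine ((Basis.orientation_eq_iff_det_pos b c).2 ?_).symm
  rw [hdet]
  exact one_pos

theorem IsOrthonormalFrame.isNormalFrame (hb : IsOrthonormalFrame h b) (ho : b.orientation = o)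
    (hR : IsAlgCurvatureTensor R) {lam mu : Fin 3 → ℝ}
    (h1 : ∀ i, curvatureOperator h R (framePlane b i) =
      lam i • framePlane b i + mu i • framePlanePerp b i)
    (h2 : ∀ i, curvatureOperator h R (framePlanePerp b i) =
      mu i • framePlane b i + lam i • framePlanePerp b i) :
    IsNormalFrame h o R lam mu b := by
  have hP : ∀ i, framePlane b i ∈ unitPlanes h := fun i => by
    refine ⟨by simp [hb.ip2_framePlane], ?_⟩
    fin_cases i <;> exact ⟨_, _, rfl⟩
  have hQ : ∀ i, framePlanePerp b i ∈ unitPlanes h := fun i => by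
    refine ⟨by simp [hb.ip2_framePlanePerp], ?_⟩
    fin_cases i <;> exact ⟨_, _, rfl⟩
  refine ⟨hb, ⟨b, rfl, ho⟩, fun i => ?_, fun i => ?_, fun i => ?_, h1, h2⟩
  · rw [hb.hodgeStar_eq ho, hb.frameStar_framePlane]
  · exact hb.isCriticalPlane_of_apply_eq hR (hP i) (by rw [h1, hb.frameStar_framePlane])
  · exact hb.isCriticalPlane_of_apply_eq hR (hQ i)
      (by rw [h2, hb.frameStar_framePlanePerp, add_comm])

theorem IsOrthonormalFrame.isSymmetric_dualBlock (hb : IsOrthonormalFrame h b)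
    (hR : IsAlgCurvatureTensor R) (s : ℝ) :
    (dualCoord h s b ∘ₗ curvatureOperator h R ∘ₗ dualMap s b).IsSymmetric := by
  intro a a'
  have h1 := hb.ip2_dualMap_right s (curvatureOperator h R (dualMap s b a)) a'
  have h2 := hb.ip2_dualMap_right s (curvatureOperator h R (dualMap s b a')) a
  rw [hb.ip2_curvatureOperator_comm hR, ip2_symm hb.symm, h2] at h1
  simp only [LinearMap.comp_apply]
  rw [real_inner_comm _ a]
  linarith

theorem IsOrthonormalFrame.exists_isNormalFrame (hb : IsOrthonormalFrame h b)
    (ho : b.orientation = o) (hR : IsAlgCurvatureTensor R) (hcomm : CommutesWithStar h o R) :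
    ∃ lam mu : Fin 3 → ℝ, Antitone (lam + mu) ∧ Antitone (lam - mu) ∧
      ∃ e : Fin 4 → V, IsNormalFrame h o R lam mu e := by
  rw [CommutesWithStar, hb.hodgeStar_eq ho] at hcomm
  obtain ⟨d, a, hd, h0, h1, h01, h2, ha⟩ :=
    exists_sorted_eigenbasis (hb.isSymmetric_dualBlock hR 1)
  obtain ⟨d', a', hd', h0', h1', h01', h2', ha'⟩ :=
    exists_sorted_eigenbasis (hb.isSymmetric_dualBlock hR (-1))
  obtain ⟨c, hc, hco, hP, hQ⟩ := hb.exists_frame h0 h1 h01 h2 h0' h1' h01' h2'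
  have k1 : ∀ i, curvatureOperator h R (dualMap 1 b (a i)) = d i • dualMap 1 b (a i) := fun i => by
    rw [hb.apply_dualMap_of_commute hcomm (Or.inl rfl), ← map_smul, ← ha]
    rfl
  have k2 : ∀ i, curvatureOperator h R (dualMap (-1) b (a' i)) = d' i • dualMap (-1) b (a' i) :=
    fun i => by
      rw [hb.apply_dualMap_of_commute hcomm (Or.inr rfl), ← map_smul, ← ha']
      rfl
  -- Solves λ + μ = d and λ - μ = d', the sorted spectra on Λ⁺ and Λ⁻.
  refine ⟨(2⁻¹ : ℝ) • (d + d'), (2⁻¹ : ℝ) • (d - d'), ?_, ?_, c,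
    hc.isNormalFrame (hco.trans ho) hR (fun i => ?_) (fun i => ?_)⟩
  · have : (2⁻¹ : ℝ) • (d + d') + (2⁻¹ : ℝ) • (d - d') = d := by module
    rwa [this]
  · have : (2⁻¹ : ℝ) • (d + d') - (2⁻¹ : ℝ) • (d - d') = d' := by module
    rwa [this]
  · simp only [hP, hQ, map_add, k1, k2, Pi.smul_apply, Pi.add_apply, Pi.sub_apply, smul_eq_mul]
    module
  · simp only [hP, hQ, map_sub, k1, k2, Pi.smul_apply, Pi.add_apply, Pi.sub_apply, smul_eq_mul]
    module

/-! ### Uniqueness -/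

theorem dualMap_single (s : ℝ) (e : Fin 4 → V) (k : Fin 3) :
    dualMap s e (EuclideanSpace.single k 1) =
      (2⁻¹ : ℝ) • (framePlane e k + s • framePlanePerp e k) := by
  simp [dualMap_apply, -smul_add]

theorem IsNormalFrame.apply_dualMap_single {e : Fin 4 → V} {lam mu : Fin 3 → ℝ}
    (H : IsNormalFrame h o R lam mu e) {s : ℝ} (hs : s * s = 1) (k : Fin 3) :
    curvatureOperator h R (dualMap s e (EuclideanSpace.single k 1)) =
      (lam k + s * mu k) • dualMap s e (EuclideanSpace.single k 1) := by
  rw [dualMap_single, map_smul, map_add, map_smul, H.apply, H.apply_perp, smul_comm]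
  congr 1
  linear_combination (norm := module) (-mu k * hs) • framePlanePerp e k

/-- The polynomial determines the multiset of its roots, and a multiset has only one decreasing
enumeration. -/
theorem eq_of_prod_X_sub_C_eq {n : ℕ} {d d' : Fin n → ℝ} (hd : Antitone d) (hd' : Antitone d')
    (h : ∏ i, (Polynomial.X - Polynomial.C (d i)) = ∏ i, (Polynomial.X - Polynomial.C (d' i))) :
    d = d' := by
  have hroots : ∀ d : Fin n → ℝ, (∏ i, (Polynomial.X - Polynomial.C (d i))).roots =
      (List.ofFn d : Multiset ℝ) := by
    intro d
    have := Polynomial.roots_multiset_prod_X_sub_C (Multiset.map d Finset.univ.val)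
    rw [Multiset.map_map] at this
    rw [← Fin.univ_val_map, ← this]
    rfl
  have h1 := congrArg Polynomial.roots h
  rw [hroots, hroots, Multiset.coe_eq_coe] at h1
  exact List.ofFn_injective (h1.eq_of_sortedGE (List.sortedGE_ofFn_iff.2 hd)
    (List.sortedGE_ofFn_iff.2 hd'))

theorem IsNormalFrame.charpoly_dualBlock {lam mu : Fin 3 → ℝ} (hb : IsOrthonormalFrame h b)
    (H : IsNormalFrame h o R lam mu b) {s : ℝ} (hs : s * s = 1) :
    (dualCoord h s b ∘ₗ curvatureOperator h R ∘ₗ dualMap s b).charpoly =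
      ∏ i, (Polynomial.X - Polynomial.C (lam i + s * mu i)) := by
  let u := (EuclideanSpace.basisFun (Fin 3) ℝ).toBasis
  rw [← LinearMap.charpoly_toMatrix _ u, ← Matrix.charpoly_diagonal]
  congr 1
  ext i j
  rw [LinearMap.toMatrix_apply]
  have : u j = EuclideanSpace.single j 1 := by simp [u]
  rw [this, LinearMap.comp_apply, LinearMap.comp_apply, H.apply_dualMap_single hs, map_smul,
    hb.dualCoord_dualMap, hs]
  rw [Matrix.diagonal_apply]
  rcases eq_or_ne i j with rfl | hij
  · norm_num [u]
  · simp [u, hij]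

/-- Both frames have the same star, hence the same Λ⁺ and Λ⁻, and the blocks of R̂ in the two
coordinate systems are conjugate. The sign s covers λ + μ and λ - μ together. -/
theorem IsNormalFrame.unique {e e' : Fin 4 → V} {lam mu lam' mu' : Fin 3 → ℝ}
    (hcomm : CommutesWithStar h o R)
    (H : IsNormalFrame h o R lam mu e) (H' : IsNormalFrame h o R lam' mu' e') {s : ℝ}
    (hs : s = 1 ∨ s = -1) (hd : Antitone (lam + s • mu)) (hd' : Antitone (lam' + s • mu')) :
    lam + s • mu = lam' + s • mu' := by
  obtain ⟨b, rfl, ho⟩ := H.positive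
  obtain ⟨b', rfl, ho'⟩ := H'.positive
  have hb := H.orthonormal
  have hb' := H'.orthonormal
  have hss : s * s = 1 := by rcases hs with rfl | rfl <;> norm_num
  have hstar : frameStar h b' = frameStar h b := by
    rw [← hb.hodgeStar_eq ho, ← hb'.hodgeStar_eq ho']
  rw [CommutesWithStar, hb.hodgeStar_eq ho] at hcomm
  have h1 : ∀ a, dualMap s b (dualCoord h s b (dualMap s b' a)) = dualMap s b' a := fun a =>
    (hb.eq_dualMap_of_frameStar_eq hs (by rw [← hstar, hb'.frameStar_dualMap hss])).symm
  have h2 : ∀ a, dualMap s b' (dualCoord h s b' (dualMap s b a)) = dualMap s b a := fun a =>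
    (hb'.eq_dualMap_of_frameStar_eq hs (by rw [hstar, hb.frameStar_dualMap hss])).symm
  have hid : ∀ a, dualCoord h s b (dualMap s b a) = a := fun a => by
    rw [hb.dualCoord_dualMap, hss]; norm_num
  have hid' : ∀ a, dualCoord h s b' (dualMap s b' a) = a := fun a => by
    rw [hb'.dualCoord_dualMap, hss]; norm_num
  let U : E3 ≃ₗ[ℝ] E3 := LinearEquiv.ofLinearMap (dualCoord h s b' ∘ₗ dualMap s b)
    (dualCoord h s b ∘ₗ dualMap s b')
    (LinearMap.ext fun a => by
      simp only [LinearMap.comp_apply, LinearMap.id_apply, h1, hid'])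
    (LinearMap.ext fun a => by
      simp only [LinearMap.comp_apply, LinearMap.id_apply, h2, hid])
  have hconj : U.conj (dualCoord h s b ∘ₗ curvatureOperator h R ∘ₗ dualMap s b) =
      dualCoord h s b' ∘ₗ curvatureOperator h R ∘ₗ dualMap s b' := by
    refine LinearMap.ext fun a => ?_
    rw [LinearEquiv.conj_apply_apply]
    change dualCoord h s b' (dualMap s b (dualCoord h s b (curvatureOperator h R (dualMap s b
      (dualCoord h s b (dualMap s b' a)))))) = dualCoord h s b' (curvatureOperator h R
        (dualMap s b' a))
    rw [← hb.apply_dualMap_of_commute hcomm hs, h1]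
  apply eq_of_prod_X_sub_C_eq hd hd'
  have := LinearEquiv.charpoly_conj U (dualCoord h s b ∘ₗ curvatureOperator h R ∘ₗ dualMap s b)
  rw [hconj, H'.charpoly_dualBlock hb' hss, H.charpoly_dualBlock hb hss] at this
  exact this.symm

end NormalForm

/-! ### Reconstruction from critical points and values -/

section Determined

variable {V : Type*} [AddCommGroup V] [Module ℝ V] {h : LinearMap.BilinForm ℝ V}
  {b : Basis (Fin 4) ℝ V} {R R' : V → V → V → V → ℝ} {o : Orientation ℝ V (Fin 4)}

/-! ### Recovering the operator from its critical points and values -/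

/-- Criticality controls only the image of the sum; since R̂ preserves Λ⁺ and Λ⁻, projecting to each
of them separates the two eigenvector equations. -/
theorem IsOrthonormalFrame.apply_dualMap_of_isCriticalPlane (hb : IsOrthonormalFrame h b)
    (hR : IsAlgCurvatureTensor R)
    (hA : curvatureOperator h R ∘ₗ frameStar h b = frameStar h b ∘ₗ curvatureOperator h R)
    {a a' : E3} (ha : ‖a‖ = 1) (ha' : ‖a'‖ = 1)
    (hP : IsCriticalPlane h R (dualMap 1 b a + dualMap (-1) b a')) :
    ∃ l m : ℝ, curvatureOperator h R (dualMap 1 b a) = l • dualMap 1 b a ∧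
      curvatureOperator h R (dualMap (-1) b a') = m • dualMap (-1) b a' := by
  obtain ⟨l, m, hlm⟩ := hb.apply_of_isCriticalPlane hR ha ha' hP
  have h1 := hb.apply_dualMap_of_commute hA (Or.inl rfl) a
  have h2 := hb.apply_dualMap_of_commute hA (Or.inr rfl) a'
  rw [map_add, h1, h2] at hlm
  have k1 := congrArg (dualCoord h 1 b) hlm
  have k2 := congrArg (dualCoord h (-1) b) hlm
  simp only [map_add, map_smul, hb.dualCoord_dualMap] at k1 k2
  norm_num at k1 k2
  exact ⟨l, m, by rw [h1, k1, map_smul], by rw [h2, k2, map_smul]⟩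

theorem IsOrthonormalFrame.curvatureForm_dualMap_add (hb : IsOrthonormalFrame h b)
    {a a' : E3} (ha : ‖a‖ = 1) (ha' : ‖a'‖ = 1) {l m : ℝ}
    (h1 : curvatureOperator h R (dualMap 1 b a) = l • dualMap 1 b a)
    (h2 : curvatureOperator h R (dualMap (-1) b a') = m • dualMap (-1) b a') :
    curvatureForm h R (dualMap 1 b a + dualMap (-1) b a') = 2⁻¹ * (l + m) := by
  rw [curvatureForm, map_add (curvatureOperator h R), h1, h2, map_add (ip2 h _),
    hb.ip2_dualMap_right, hb.ip2_dualMap_right]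
  simp only [map_add, map_smul, hb.dualCoord_dualMap, inner_add_left, real_inner_smul_left]
  norm_num [real_inner_self_eq_norm_sq, ha, ha']
  ring

theorem framePlane_eq_dualMap (e : Fin 4 → V) (k : Fin 3) : framePlane e k =
    dualMap 1 e (EuclideanSpace.single k 1) + dualMap (-1) e (EuclideanSpace.single k 1) := by
  rw [dualMap_single, dualMap_single]
  module

theorem framePlanePerp_eq_dualMap (e : Fin 4 → V) (k : Fin 3) : framePlanePerp e k =
    dualMap 1 e (EuclideanSpace.single k 1) - dualMap (-1) e (EuclideanSpace.single k 1) := by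
  rw [dualMap_single, dualMap_single]
  module

/-- The difference of the traces on Λ⁺ and Λ⁻ is the trace of ⋆R̂, which the Bianchi identity
annihilates. -/
theorem IsOrthonormalFrame.sum_eq_of_apply_dualMap (hb : IsOrthonormalFrame h b)
    (hR : IsAlgCurvatureTensor R) {s t : Fin 3 → ℝ}
    (h1 : ∀ i, curvatureOperator h R (dualMap 1 b (EuclideanSpace.single i 1)) =
      s i • dualMap 1 b (EuclideanSpace.single i 1))
    (h2 : ∀ i, curvatureOperator h R (dualMap (-1) b (EuclideanSpace.single i 1)) =
      t i • dualMap (-1) b (EuclideanSpace.single i 1)) : ∑ i, s i = ∑ i, t i := by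
  have h3 := hb.sum_ip2_curvatureOperator hR
  have h4 : ∀ k, ip2 h (curvatureOperator h R (framePlane b k)) (framePlanePerp b k) =
      2⁻¹ * (s k - t k) := fun k => by
    rw [framePlanePerp_eq_dualMap, framePlane_eq_dualMap, map_add, h1, h2, map_sub (ip2 h _),
      hb.ip2_dualMap_right, hb.ip2_dualMap_right]
    simp only [map_add, map_smul, hb.dualCoord_dualMap, inner_add_left, real_inner_smul_left]
    norm_num
    ring
  simp only [h4, ← Finset.mul_sum, Finset.sum_sub_distrib] at h3
  linarith

theorem IsNormalFrame.curvatureOperator_eq {lam mu : Fin 3 → ℝ} {e : Fin 4 → V}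
    (H : IsNormalFrame h o R lam mu e) (hR : IsAlgCurvatureTensor R)
    (hR' : IsAlgCurvatureTensor R') (hcomm : CommutesWithStar h o R')
    (hcrit : ∀ P, IsCriticalPlane h R P → IsCriticalPlane h R' P)
    (hval : ∀ P, IsCriticalPlane h R P → curvatureForm h R P = curvatureForm h R' P) :
    curvatureOperator h R' = curvatureOperator h R := by
  obtain ⟨b, rfl, ho⟩ := H.positive
  have hb := H.orthonormal
  rw [CommutesWithStar, hb.hodgeStar_eq ho] at hcomm
  have hn : ∀ i, ‖(EuclideanSpace.single i 1 : E3)‖ = 1 := fun i => by simp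
  have e1 := fun i => H.apply_dualMap_single (s := 1) (by norm_num) i
  have e2 := fun i => H.apply_dualMap_single (s := -1) (by norm_num) i
  -- All nine sums of eigenvectors are used, not only the three with i = j that are frame planes.
  have hc : ∀ i j, IsCriticalPlane h R (dualMap 1 b (EuclideanSpace.single i 1) +
      dualMap (-1) b (EuclideanSpace.single j 1)) := fun i j => by
    refine hb.isCriticalPlane_of_apply_eq hR (hb.dualMap_add_mem_unitPlanes (hn i) (hn j))
      (l := 2⁻¹ * ((lam i + 1 * mu i) + (lam j + -1 * mu j)))
      (m := 2⁻¹ * ((lam i + 1 * mu i) - (lam j + -1 * mu j))) ?_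
    rw [map_add, map_add, e1, e2, hb.frameStar_dualMap (by norm_num),
      hb.frameStar_dualMap (by norm_num)]
    module
  have hex := fun i j => hb.apply_dualMap_of_isCriticalPlane hR' hcomm (hn i) (hn j)
    (hcrit _ (hc i j))
  choose l m hl hm using hex
  -- The eigenvalues were chosen separately for every pair; one index is fixed to obtain a single
  -- list on each half.
  have f1 := fun i => hl i 0
  have f2 := fun j => hm 0 j
  have hsum := hb.sum_eq_of_apply_dualMap hR e1 e2
  have hsum' := hb.sum_eq_of_apply_dualMap hR' f1 f2
  have hv : ∀ i j, l i 0 + m 0 j = (lam i + 1 * mu i) + (lam j + -1 * mu j) := fun i j => by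
    have := hval _ (hc i j)
    rw [hb.curvatureForm_dualMap_add (hn i) (hn j) (e1 i) (e2 j),
      hb.curvatureForm_dualMap_add (hn i) (hn j) (f1 i) (f2 j)] at this
    linarith
  simp only [Fin.sum_univ_three] at hsum hsum'
  have v0 := hv 0 0
  have v1 := hv 1 1
  have v2 := hv 2 2
  -- The values give all sums of an eigenvalue on Λ⁺ and one on Λ⁻; equality of the traces for both
  -- operators removes the remaining common shift.
  have hl0 : ∀ i, l i 0 = lam i + 1 * mu i := fun i => by
    linarith [hv i 0, hv i 1, hv i 2, hv 0 0, hv 1 0, hv 2 0]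
  have hm0 : ∀ j, m 0 j = lam j + -1 * mu j := fun j => by
    linarith [hv 0 j, hl0 0]
  refine hb.hom_ext (fun k => ?_) fun k => ?_
  · rw [framePlane_eq_dualMap, map_add, map_add, f1, f2, e1, e2, hl0, hm0]
  · rw [framePlanePerp_eq_dualMap, map_sub, map_sub, f1, f2, e1, e2, hl0, hm0]

theorem IsOrthonormalFrame.eq_of_curvatureOperator_eq (hb : IsOrthonormalFrame h b)
    (hR : IsAlgCurvatureTensor R) (hR' : IsAlgCurvatureTensor R')
    (hA : curvatureOperator h R' = curvatureOperator h R) : R' = R := by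
  ext v w x y
  rw [hb.isCurvatureOperator hR, hb.isCurvatureOperator hR', hA]

theorem IsOrthonormalFrame.existsUnique_normalForm (hb : IsOrthonormalFrame h b)
    (ho : b.orientation = o) (hR : IsAlgCurvatureTensor R) (hcomm : CommutesWithStar h o R) :
    ∃! c : (Fin 3 → ℝ) × (Fin 3 → ℝ), Antitone (c.1 + c.2) ∧ Antitone (c.1 - c.2) ∧
      ∃ e : Fin 4 → V, IsNormalFrame h o R c.1 c.2 e := by
  obtain ⟨lam, mu, h1, h2, e, H⟩ := hb.exists_isNormalFrame ho hR hcomm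
  refine ⟨(lam, mu), ⟨h1, h2, e, H⟩, ?_⟩
  rintro ⟨lam', mu'⟩ ⟨h1', h2', e', H'⟩
  have k1 := IsNormalFrame.unique hcomm H H' (Or.inl rfl) (by rwa [one_smul]) (by rwa [one_smul])
  have k2 := IsNormalFrame.unique hcomm H H' (Or.inr rfl)
    (by rwa [neg_one_smul, ← sub_eq_add_neg]) (by rwa [neg_one_smul, ← sub_eq_add_neg])
  simp only [one_smul, neg_one_smul] at k1 k2
  refine Prod.ext (funext fun i => ?_) (funext fun i => ?_) <;>
  · have r1 := congrFun k1 i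
    have r2 := congrFun k2 i
    simp only [Pi.add_apply, Pi.neg_apply] at r1 r2
    change _ = _
    linarith

end Determined

/-! ### Oriented orthonormal bases -/

section OrthonormalBasis

variable {V : Type*} [AddCommGroup V] [Module ℝ V] {h : LinearMap.BilinForm ℝ V}

theorem exists_orthonormal_basis (hV : finrank ℝ V = 4) (hs : ∀ v w, h v w = h w v)
    (hp : ∀ v, v ≠ 0 → 0 < h v v) (o : Orientation ℝ V (Fin 4)) :
    ∃ b : Basis (Fin 4) ℝ V, IsOrthonormalFrame h b ∧ b.orientation = o := by
  have : FiniteDimensional ℝ V := .of_finrank_eq_succ hV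
  obtain ⟨v, hv⟩ := LinearMap.BilinForm.exists_orthogonal_basis (B := h) ⟨hs⟩
  let v' := v.reindex (finCongr hV)
  have hv' : ∀ i j, i ≠ j → h (v' i) (v' j) = 0 := fun i j hij => by
    simp only [v', Basis.reindex_apply]
    exact hv (by simpa using hij)
  have hpos : ∀ i, 0 < h (v' i) (v' i) := fun i => hp _ (v'.ne_zero i)
  have hsq : ∀ i, √(h (v' i) (v' i)) ≠ 0 := fun i => (Real.sqrt_pos.2 (hpos i)).ne'
  let u := v'.isUnitSMul (w := fun i => (√(h (v' i) (v' i)))⁻¹)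
    (fun i => (inv_ne_zero (hsq i)).isUnit)
  have hu : IsOrthonormalFrame h u := by
    intro i j
    simp only [u, Basis.isUnitSMul_apply, map_smul, LinearMap.smul_apply, smul_eq_mul]
    split_ifs with hij
    · subst hij
      have := Real.mul_self_sqrt (hpos i).le
      have := hsq i
      field_simp
      linarith
    · rw [hv' i j hij, mul_zero, mul_zero]
  -- Adjusting the orientation changes basis vectors by signs only, which preserves orthonormality.
  refine ⟨u.adjustToOrientation o, fun i j => ?_, u.orientation_adjustToOrientation o⟩
  rcases eq_or_ne i j with rfl | hij
  · have := hu i i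
    rcases u.adjustToOrientation_apply_eq_or_eq_neg o i with h1 | h1 <;> rw [h1] <;>
      simpa using this
  · have := hu i j
    rw [if_neg hij] at this ⊢
    rcases u.adjustToOrientation_apply_eq_or_eq_neg o i with h1 | h1 <;>
      rcases u.adjustToOrientation_apply_eq_or_eq_neg o j with h2 | h2 <;> rw [h1, h2] <;>
        simpa using this

end OrthonormalBasis

/-! ### Positivity of the metric h -/

/-- The reverse Cauchy–Schwarz inequality, in an orthonormal frame. -/
theorem spatial_sq_le {t₀ t₁ t₂ t₃ w₀ w₁ w₂ w₃ : ℝ}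
    (ht : -(t₀ * t₀) + t₁ * t₁ + t₂ * t₂ + t₃ * t₃ = -1)
    (hw : -(t₀ * w₀) + t₁ * w₁ + t₂ * w₂ + t₃ * w₃ = 0) :
    w₁ ^ 2 + w₂ ^ 2 + w₃ ^ 2 ≤
      t₀ ^ 2 * (-(w₀ * w₀) + w₁ * w₁ + w₂ * w₂ + w₃ * w₃) := by
  have h1 : t₀ ^ 2 = 1 + t₁ ^ 2 + t₂ ^ 2 + t₃ ^ 2 := by linarith
  have h2 : t₀ ^ 2 * (w₀ * w₀) = (t₁ * w₁ + t₂ * w₂ + t₃ * w₃) ^ 2 := by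
    have : t₁ * w₁ + t₂ * w₂ + t₃ * w₃ = t₀ * w₀ := by linarith
    rw [this]
    ring
  have h3 : t₀ ^ 2 * (-(w₀ * w₀) + w₁ * w₁ + w₂ * w₂ + w₃ * w₃) =
      t₀ ^ 2 * (w₁ * w₁ + w₂ * w₂ + w₃ * w₃) - t₀ ^ 2 * (w₀ * w₀) := by ring
  rw [h3, h2, h1]
  nlinarith [sq_nonneg (t₁ * w₂ - t₂ * w₁), sq_nonneg (t₁ * w₃ - t₃ * w₁),
    sq_nonneg (t₂ * w₃ - t₃ * w₂)]

variable {M : Type*} [TopologicalSpace M] [ChartedSpace E4 M] [IsManifold (𝓡 4) ∞ M]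

namespace LorentzianMetric

variable (g : LorentzianMetric M) (T : UnitTimelikeField M g)

theorem deformation_apply (p : M) (v w : TangentSpace (𝓡 4) p) : g.deformation T p v w =
    g.inner p v w + 2 * (g.inner p (T.vec p) v * g.inner p (T.vec p) w) := rfl

theorem deformation_symm (p : M) (v w : TangentSpace (𝓡 4) p) :
    g.deformation T p v w = g.deformation T p w v := by
  rw [deformation_apply, deformation_apply, g.symm p v w, mul_comm (g.inner p (T.vec p) v)]

theorem deformation_vec (p : M) : g.deformation T p (T.vec p) (T.vec p) = 1 := by
  rw [deformation_apply, T.unit]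
  norm_num

theorem pos_of_orthogonal {p : M} {w : TangentSpace (𝓡 4) p} (hw : g.inner p (T.vec p) w = 0) :
    0 ≤ g.inner p w w ∧ (g.inner p w w = 0 → w = 0) := by
  obtain ⟨b, hb⟩ := g.exists_basis p
  have hsum : ∀ x y : TangentSpace (𝓡 4) p, g.inner p x y =
      -(b.repr x 0 * b.repr y 0) + b.repr x 1 * b.repr y 1 + b.repr x 2 * b.repr y 2 +
        b.repr x 3 * b.repr y 3 := by
    intro x y
    conv_lhs => rw [← b.sum_repr x, ← b.sum_repr y]
    simp only [map_sum, map_smul, sum_apply, smul_apply, hb]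
    simp [Fin.sum_univ_four]
    ring
  have hT := T.unit p
  rw [hsum] at hT hw
  have h1 := spatial_sq_le hT hw
  rw [← hsum w w] at h1
  have ht0 : 0 < (b.repr (T.vec p) 0) ^ 2 := by nlinarith
  refine ⟨nonneg_of_mul_nonneg_right (le_trans (by positivity) h1) ht0, fun h0 => ?_⟩
  rw [h0, mul_zero] at h1
  have r1 : b.repr w 1 = 0 := by nlinarith
  have r2 : b.repr w 2 = 0 := by nlinarith
  have r3 : b.repr w 3 = 0 := by nlinarith
  have r0 : b.repr w 0 = 0 := by
    rw [r1, r2, r3] at hw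
    have : b.repr (T.vec p) 0 * b.repr w 0 = 0 := by linarith
    exact (mul_eq_zero.1 this).resolve_left fun h => by simp [h] at ht0
  apply b.ext_elem
  intro i
  fin_cases i <;> simpa

/-- With a = g(T, v) and w = v + aT orthogonal to T, one gets h(v, v) = g(w, w) + a², and the
orthogonal complement of T is spacelike. -/
theorem deformation_pos (p : M) {v : TangentSpace (𝓡 4) p} (hv : v ≠ 0) :
    0 < g.deformation T p v v := by
  set a := g.inner p (T.vec p) v with ha
  set w := v + a • T.vec p with hw
  have hTw : g.inner p (T.vec p) w = 0 := by
    rw [hw, map_add, map_smul, T.unit, ← ha, smul_eq_mul]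
    ring
  have hvw : g.deformation T p v v = g.inner p w w + a ^ 2 := by
    have h1 : g.inner p w w = g.inner p v w := by
      have h2 : g.inner p w (v + a • T.vec p) = g.inner p w v + a * g.inner p w (T.vec p) := by
        rw [map_add, map_smul, smul_eq_mul]
      rwa [← hw, g.symm p w (T.vec p), hTw, mul_zero, add_zero, g.symm p w v] at h2
    rw [h1, hw, map_add, map_smul, g.symm p v (T.vec p), deformation_apply, ← ha, smul_eq_mul]
    ring
  obtain ⟨h1, h2⟩ := g.pos_of_orthogonal T hTw
  rw [hvw]
  by_contra hle
  have ha0 : a = 0 := by nlinarith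
  refine hv ?_
  rw [← h2 (by nlinarith), hw, ha0, zero_smul, add_zero]

theorem exists_orthonormal_basis (p : M) (o : Orientation ℝ (TangentSpace (𝓡 4) p) (Fin 4)) :
    ∃ b : Basis (Fin 4) ℝ (TangentSpace (𝓡 4) p),
      IsOrthonormalFrame (g.deformation T p) b ∧ b.orientation = o :=
  LorentzNormalForm.exists_orthonormal_basis (finrank_tangentSpace p) (g.deformation_symm T p)
    (fun _ => g.deformation_pos T p) o

end LorentzianMetric

/-! ### The trace of the curvature tensor -/

/-- The endomorphism `u ↦ R(u, w)w`. -/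
def jacobiEndo (G : E4 → E4 →L[ℝ] E4 →L[ℝ] ℝ) (y w : E4) : E4 →L[ℝ] E4 :=
  ((fderiv ℝ (christoffelCLM G) y).flip w).flip w - (fderiv ℝ (christoffelCLM G) y w).flip w +
    (christoffelCLM G y).flip (christoffelCLM G y w w) -
    (christoffelCLM G y w).comp ((christoffelCLM G y).flip w)

theorem IsMetricNear.jacobiEndo_apply {G : E4 → E4 →L[ℝ] E4 →L[ℝ] ℝ} {y : E4}
    (hG : IsMetricNear G y) (u w : E4) : jacobiEndo G y w u = riemannEndo G y u w w := by
  rw [hG.riemannEndo_eq]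
  rfl

theorem IsMetricNear.contDiffAt_trace_jacobiEndo {G : E4 → E4 →L[ℝ] E4 →L[ℝ] ℝ} {y : E4}
    (hG : IsMetricNear G y) (w : E4) : ContDiffAt ℝ ∞
      (fun z : E4 × E4 => LinearMap.trace ℝ E4 (jacobiEndo G z.1 z.2 : E4 →ₗ[ℝ] E4)) (y, w) := by
  have h1 : ContDiffAt ℝ ∞ (fun z : E4 × E4 => christoffelCLM G z.1) (y, w) :=
    ContDiffAt.comp (y, w) (f := Prod.fst) hG.contDiffAt_christoffel contDiffAt_fst
  have h2 : ContDiffAt ℝ ∞ (fun z : E4 × E4 => fderiv ℝ (christoffelCLM G) z.1) (y, w) :=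
    ContDiffAt.comp (y, w) (f := Prod.fst)
      (hG.contDiffAt_christoffel.fderiv_right (m := ∞) (by simp)) contDiffAt_fst
  have h3 : ContDiffAt ℝ ∞ (fun z : E4 × E4 => z.2) (y, w) := contDiffAt_snd
  have hc : ∀ u : E4, ContDiffAt ℝ ∞ (fun _ : E4 × E4 => u) (y, w) := fun u => contDiffAt_const
  simp only [LinearMap.trace_eq_sum_inner _ (EuclideanSpace.basisFun (Fin 4) ℝ)]
  refine ContDiffAt.sum fun i _ => ?_
  generalize EuclideanSpace.basisFun (Fin 4) ℝ i = u
  have e1 : ContDiffAt ℝ ∞ (fun z : E4 × E4 => fderiv ℝ (christoffelCLM G) z.1 u z.2 z.2) (y, w) :=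
    ((h2.clm_apply (hc u)).clm_apply h3).clm_apply h3
  have e2 : ContDiffAt ℝ ∞ (fun z : E4 × E4 => fderiv ℝ (christoffelCLM G) z.1 z.2 u z.2) (y, w) :=
    ((h2.clm_apply h3).clm_apply (hc u)).clm_apply h3
  have e3 : ContDiffAt ℝ ∞
      (fun z : E4 × E4 => christoffelCLM G z.1 u (christoffelCLM G z.1 z.2 z.2)) (y, w) :=
    (h1.clm_apply (hc u)).clm_apply ((h1.clm_apply h3).clm_apply h3)
  have e4 : ContDiffAt ℝ ∞
      (fun z : E4 × E4 => christoffelCLM G z.1 z.2 (christoffelCLM G z.1 u z.2)) (y, w) :=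
    (h1.clm_apply h3).clm_apply ((h1.clm_apply (hc u)).clm_apply h3)
  have h4 : ContDiffAt ℝ ∞ (fun z : E4 × E4 => jacobiEndo G z.1 z.2 u) (y, w) :=
    ((e1.sub e2).add e3).sub e4
  exact (hc u).inner ℝ h4

namespace LorentzianMetric

variable (g : LorentzianMetric M) (T : UnitTimelikeField M g) {c q : M}

/-- In an h-orthonormal basis the trace of u ↦ R(u, T)T is a sum of h-products; the correction 2 T♭
⊗ T♭ contributes g(R(u, T)T, T) = 0, leaving g-products. No smooth local h-orthonormal frame is
needed. -/
theorem metricTrace_vec_eq (hq : q ∈ (chartAt E4 c).source) :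
    metricTrace (g.deformation T q) (g.riemann q) (T.vec q) (T.vec q) =
      LinearMap.trace ℝ E4 (jacobiEndo (g.inChart c) (extChartAt (𝓡 4) c q)
        (chartCoord c q (T.vec q)) : E4 →ₗ[ℝ] E4) := by
  obtain ⟨b, hb, -⟩ := g.exists_orthonormal_basis T q (Module.finBasisOfFinrankEq ℝ _
    (finrank_tangentSpace q)).orientation
  have hR := g.isAlgCurvatureTensor_riemann q
  have hG := g.isMetricNear_inChart (c := c) (y := extChartAt (𝓡 4) c q)
    ((extChartAt (𝓡 4) c).map_source (by rwa [extChartAt_source]))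
  let U : E4 ≃ₗ[ℝ] TangentSpace (𝓡 4) q := LinearEquiv.ofLinearMap (chartFrame c q).toLinearMap
    (chartCoord c q).toLinearMap (LinearMap.ext fun v => chartFrame_chartCoord hq v)
    (LinearMap.ext fun v => chartCoord_chartFrame hq v)
  set J := (jacobiEndo (g.inChart c) (extChartAt (𝓡 4) c q)
    (chartCoord c q (T.vec q)) : E4 →ₗ[ℝ] E4) with hJ
  have hUJ : ∀ u v, g.inner q (U.conj J u) v = g.riemann q u (T.vec q) (T.vec q) v := by
    intro u v
    rw [← g.riemannInChart_eq_riemann hq, g.riemannInChart_eq hq, riemannForm,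
      g.inChart_extChartAt hq, ← hG.jacobiEndo_apply, chartFrame_chartCoord hq]
    rfl
  rw [← LinearMap.trace_conj' J U, LinearMap.trace_eq_matrix_trace ℝ b, Matrix.trace,
    hb.metricTrace_eq hR]
  refine Finset.sum_congr rfl fun i _ => ?_
  rw [Matrix.diag_apply, LinearMap.toMatrix_apply, ← hb.repr_eq, g.deformation_symm,
    deformation_apply, hUJ, g.symm q (T.vec q) (U.conj J (b i)), hUJ]
  have h0 := hR.antisymm_right (b i) (T.vec q) (T.vec q) (T.vec q)
  have : g.riemann q (b i) (T.vec q) (T.vec q) (T.vec q) = 0 := by linarith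
  rw [this]
  ring

theorem contMDiffAt_chartCoord_vec (c : M) :
    ContMDiffAt (𝓡 4) 𝓘(ℝ, E4) ∞ (fun q => chartCoord c q (T.vec q)) c := by
  have h := (Bundle.Trivialization.contMDiffOn_section_baseSet_iff (IB := 𝓡 4) (n := ∞)
    (trivializationAt E4 (TangentSpace (𝓡 4) : M → Type _) c)
    (s := fun q => T.vec q)).1 T.contMDiff.contMDiffOn
  have hc : (trivializationAt E4 (TangentSpace (𝓡 4) : M → Type _) c).baseSet ∈ 𝓝 c :=
    (chartAt E4 c).open_source.mem_nhds (mem_chart_source E4 c)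
  refine (h.contMDiffAt hc).congr_of_eventuallyEq ?_
  filter_upwards [hc] with q hq
  rw [chartCoord, Bundle.Trivialization.continuousLinearMapAt_apply_of_mem _ _ hq]

theorem contMDiff_metricTrace_vec : ContMDiff (𝓡 4) 𝓘(ℝ, ℝ) ∞
    (fun q => metricTrace (g.deformation T q) (g.riemann q) (T.vec q) (T.vec q)) := by
  intro c
  have hG := g.isMetricNear_inChart (c := c) (y := extChartAt (𝓡 4) c c)
    ((extChartAt (𝓡 4) c).map_source (mem_extChartAt_source c))
  have h1 : ContMDiffAt (𝓡 4) 𝓘(ℝ, E4 × E4) ∞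
      (fun q => (extChartAt (𝓡 4) c q, chartCoord c q (T.vec q))) c :=
    (contMDiffAt_extChartAt).prodMk_space (contMDiffAt_chartCoord_vec g T c)
  have h2 := (hG.contDiffAt_trace_jacobiEndo (chartCoord c c (T.vec c))).contMDiffAt.comp c h1
  refine h2.congr_of_eventuallyEq ?_
  filter_upwards [(chartAt E4 c).open_source.mem_nhds (mem_chart_source E4 c)] with q hq
  exact g.metricTrace_vec_eq T hq

theorem isStarEinstein_iff (o : ManifoldOrientation M) : g.IsStarEinstein T o ↔
    ∃ f : M → ℝ, ContMDiff (𝓡 4) 𝓘(ℝ, ℝ) ∞ f ∧ ∀ (p : M) (v w : TangentSpace (𝓡 4) p),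
      metricTrace (g.deformation T p) (g.riemann p) v w = f p * g.deformation T p v w := by
  have key : ∀ p, CommutesWithStar (g.deformation T p) (o.orient p) (g.riemann p) ↔
      ∃ f : ℝ, ∀ v w, metricTrace (g.deformation T p) (g.riemann p) v w =
        f * g.deformation T p v w := fun p => by
    obtain ⟨b, hb, ho⟩ := g.exists_orthonormal_basis T p (o.orient p)
    exact hb.commutesWithStar_iff ho (g.isAlgCurvatureTensor_riemann p)
  constructor
  · refine fun H => ⟨_, g.contMDiff_metricTrace_vec T, fun p v w => ?_⟩
    obtain ⟨f, hf⟩ := (key p).1 (H p)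
    rw [hf (T.vec p), g.deformation_vec, mul_one, hf]
  · rintro ⟨f, -, hf⟩ p
    exact (key p).2 ⟨f p, hf p⟩

end LorentzianMetric

end LorentzNormalForm

end

theorem theorem5p1 {M : Type*} [TopologicalSpace M] [T2Space M] [SecondCountableTopology M]
    [ChartedSpace LorentzNormalForm.E4 M] [IsManifold (𝓡 4) ∞ M]
    (o : LorentzNormalForm.ManifoldOrientation M) (g : LorentzNormalForm.LorentzianMetric M)
    (T : LorentzNormalForm.UnitTimelikeField M g) :
    -- the characterization of `⋆_h`-Einstein metrics by `tr_h(Rm) = f h`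
    (g.IsStarEinstein T o ↔
      ∃ f : M → ℝ, ContMDiff (𝓡 4) 𝓘(ℝ, ℝ) ∞ f ∧
        ∀ (p : M) (v w : TangentSpace (𝓡 4) p),
          LorentzNormalForm.metricTrace (g.deformation T p) (g.riemann p) v w =
            f p * g.deformation T p v w) ∧
    (g.IsStarEinstein T o → ∀ p : M,
      -- existence and uniqueness of the normal form
      (∃! c : (Fin 3 → ℝ) × (Fin 3 → ℝ), Antitone (c.1 + c.2) ∧ Antitone (c.1 - c.2) ∧
        ∃ e : Fin 4 → TangentSpace (𝓡 4) p,
          LorentzNormalForm.IsNormalFrame (g.deformation T p) (o.orient p) (g.riemann p) c.1 c.2 e) ∧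
      -- it is determined by the critical points and critical values of `P ↦ ⟨R̂ P, P⟩_h`
      (∀ R' : TangentSpace (𝓡 4) p → TangentSpace (𝓡 4) p → TangentSpace (𝓡 4) p →
          TangentSpace (𝓡 4) p → ℝ,
        LorentzNormalForm.IsAlgCurvatureTensor R' →
        LorentzNormalForm.CommutesWithStar (g.deformation T p) (o.orient p) R' →
        (∀ P, LorentzNormalForm.IsCriticalPlane (g.deformation T p) (g.riemann p) P ↔
          LorentzNormalForm.IsCriticalPlane (g.deformation T p) R' P) →
        (∀ P, LorentzNormalForm.IsCriticalPlane (g.deformation T p) (g.riemann p) P →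
          LorentzNormalForm.curvatureForm (g.deformation T p) (g.riemann p) P =
            LorentzNormalForm.curvatureForm (g.deformation T p) R' P) →
        R' = g.riemann p ∧
          LorentzNormalForm.curvatureOperator (g.deformation T p) R' =
            LorentzNormalForm.curvatureOperator (g.deformation T p) (g.riemann p))) := by
  refine ⟨g.isStarEinstein_iff T o, fun H p => ?_⟩
  obtain ⟨b, hb, ho⟩ := g.exists_orthonormal_basis T p (o.orient p)
  have hR := g.isAlgCurvatureTensor_riemann p
  refine ⟨hb.existsUnique_normalForm ho hR (H p), fun R' hR' hcomm hcrit hval => ?_⟩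
  obtain ⟨lam, mu, -, -, e, he⟩ := hb.exists_isNormalFrame ho hR (H p)
  have hA := he.curvatureOperator_eq hR hR' hcomm (fun P hP => (hcrit P).1 hP) hval
  exact ⟨hb.eq_of_curvatureOperator_eq hR hR' hA, hA⟩
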